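/- Let $\{Z(t)\}$ be an ergodic (irreducible, positive recurrent) continuous-time Markov chain on a countable set $\mathcal Z$ with transition rates $\alpha_{ii'}$, bounded exit rates $\alpha_{i\bullet}=\sum_{i'\ne i}\alpha_{ii'}$ and stationary distribution $\pi$. Consider $n\ge 1$ parallel queues. When $Z(t)=i$, jobs arrive at rate $\lambda_i$ and each joins a shortest queue (ties broken uniformly at random), and server $j$, when its queue is nonempty, completes jobs at rate $\mu_{ij}\ge 0$. The rates $\lambda_i,\mu_{ij}$ are bounded. Write $\mathbb E$ of a function of $i$ for its expectation under $i\sim\pi$, and put $\mu_{i\Sigma}=\sum_j\mu_{ij}$, $\mu_\Sigma=\mathbb E[\mu_{i\Sigma}]$, $\lambda=\mathbb E[\lambda_i]$, $\rho=\lambda/\mu_\Sigma$, $\epsilon=1-\rho$. Consider a family of such systems indexed by $\epsilon\in(0,\epsilon_0)$, where $0<\epsilon_0\le 1$, in which $\alpha$ and $\mu$ do not depend on $\epsilon$, while each $\lambda_i=\lambda_i^{(\epsilon)}$ is an affine function of $\epsilon$, bounded uniformly in $i$ and $\epsilon$. For every $\epsilon\in(0,\epsilon_0)$, let $\widetilde{\boldsymbol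 q}=\widetilde{\boldsymbol q}^{(\epsilon)}$ be the vector of queue lengths in steady state, that is, under a stationary distribution of the chain $(Z(t),\boldsymbol q(t))$, let $\widetilde q_\Sigma=\sum_j\widetilde q_j$, and assume the SSC load condition $$\lambda_i>\mu_{i\Sigma}-n\min_{j}\mu_{ij}\qquad\text{for all } i\in\mathcal Z .$$ A solution to the Poisson equation for $f:\mathcal Z\to\mathbb R$ is a function $V_f:\mathcal Z\to\mathbb R$ with $\alpha_{i\bullet}V_f(i)=f(i)-\mathbb E[f]+\sum_{i'\ne i}\alpha_{ii'}V_f(i')$ for all $i$. Let $V_h,V_k,V_\ell$ be solutions to the Poisson equations for $h(i)=\mu_{i\Sigma}-\lambda_i$, $k(i)=(\mu_{i\Sigma}-\lambda_i)V_h(i)$ and $\ell(i)=\mu_{i\Sigma}$, respectively, where the additive constant in $V_h$ is chosen for each $\epsilon$ such that $\mathbb E[V_h(i)]$ stays bounded over $\epsilon\in(0,\epsilon_0)$. Assume that, for some $\eta,\zeta,\beta>0$ and all $\epsilon\in(0,\epsilon_0)$, $\mathbb E|V_h(i)|^{1+\eta}<\infty$, $\mathbb E|V_k(i)|^{1+\zeta}<\infty$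 and $\mathbb E|V_\ell(i)|^{1+\beta}<\infty$. Then the limit $k^*=\lim_{\epsilon\downarrow0}\mathbb E[k(i)]$ exists and is finite and, for every $s>0$, $1+\frac sn\left(1+\frac{k^*}{\mu_\Sigma}\right)>0$ and, as $\epsilon\downarrow 0$, $$\mathbb E\left[e^{-s\epsilon\widetilde q_\Sigma/n}\right]=\frac{1}{1+\frac sn\left(1+\frac{k^*}{\mu_\Sigma}\right)}+O\left(\epsilon^{1-\frac1{1+\min\{1,\eta\}}}\right).$$ -/

import Mathlib

open Filter Topology Asymptotics Set

/-- The expectation `E[f(X)]` for a discrete random variable `X` with law `p`. -/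
noncomputable def expect {X : Type*} (p : PMF X) (f : X → ℝ) : ℝ :=
  ∑' x, (p x).toReal * f x

/-- `E[|f(X)|] < ∞` (for real series, summability is absolute summability). -/
def HasFiniteMean {X : Type*} (p : PMF X) (f : X → ℝ) : Prop :=
  Summable fun x => (p x).toReal * f x

/-- The total rate `∑_{y ≠ x} G x y` at which a continuous-time Markov chain leaves `x`. -/
noncomputable def exitRate {X : Type*} (G : X → X → ℝ) (x : X) : ℝ :=
  ∑' y : {y // y ≠ x}, G x y

/-- `G` is a (stable, conservative) transition rate matrix. -/
structure IsRateMatrix {X : Type*} (G : X → X → ℝ) : Prop where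
  nonneg : ∀ x y, x ≠ y → 0 ≤ G x y
  summable : ∀ x, Summable fun y : {y // y ≠ x} => G x y
  diag : ∀ x, G x x = -exitRate G x

/-- The exit rates are bounded: `sup_x |G x x| < ∞`. -/
def HasBoundedRates {X : Type*} (G : X → X → ℝ) : Prop :=
  ∃ C, ∀ x, exitRate G x ≤ C

/-- Every state can be reached from every other one through transitions of positive rate. -/
def IsIrreducibleChain {X : Type*} (G : X → X → ℝ) : Prop :=
  ∀ x y, Relation.ReflTransGen (fun a b => a ≠ b ∧ 0 < G a b) x y

/-- `p` is a stationary distribution of the chain with rate matrix `G`: `p G = 0`. -/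
def IsStationaryDist {X : Type*} (G : X → X → ℝ) (p : PMF X) : Prop :=
  ∀ y, HasSum (fun x => (p x).toReal * G x y) 0

/-- `V` solves the Poisson equation of `f` for the chain with rate matrix `α` and stationary
distribution `p`, that is, `V i = (f i - E f) / α_{i•} + ∑_{i' ≠ i} (α i i' / α_{i•}) * V i'`.
The equation is multiplied by the exit rate `α_{i•}`, which is positive for an irreducible chain
with at least two states, so that it also makes sense for a chain with a single state. -/
def IsPoissonSolution {Z : Type*} (α : Z → Z → ℝ) (p : PMF Z) (f V : Z → ℝ) : Prop :=
  HasFiniteMean p f ∧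
    ∀ i, Summable (fun i' : {i' // i' ≠ i} => α i i' * V i') ∧
      exitRate α i * V i = f i - expect p f + ∑' i' : {i' // i' ≠ i}, α i i' * V i'

/-- The set of servers with the fewest jobs. -/
def shortestQueues {n : ℕ} (q : Fin n → ℕ) : Finset (Fin n) :=
  Finset.univ.filter fun j => ∀ l, q j ≤ q l

/-- The probability that join-the-shortest-queue, with ties broken uniformly at random, sends an
arriving job to server `j`. -/
noncomputable def jsqRoute {n : ℕ} (q : Fin n → ℕ) (j : Fin n) : ℝ :=
  if j ∈ shortestQueues q then 1 / ((shortestQueues q).card : ℝ) else 0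

open Classical in
/-- The rate of the jump from `x = (i, q)` to a different state `y = (i', q')`: the modulating
chain moves at rate `α i i'`, an arrival at queue `j` happens at rate `lam i * jsqRoute q j`, a
departure from a nonempty queue `j` at rate `μ i j`. -/
noncomputable def jsqJumpRate {Z : Type*} {n : ℕ} (α : Z → Z → ℝ) (lam : Z → ℝ)
    (μ : Z → Fin n → ℝ) (x y : Z × (Fin n → ℕ)) : ℝ :=
  (if y.2 = x.2 then α x.1 y.1 else 0) +
    (if y.1 = x.1 then
      (∑ j, if y.2 = x.2 + Pi.single j 1 then lam x.1 * jsqRoute x.2 j else 0) +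
        ∑ j, if x.2 = y.2 + Pi.single j 1 then μ x.1 j else 0
    else 0)

open Classical in
/-- The transition rate matrix of the pair (modulating state, vector of queue lengths). -/
noncomputable def jsqRateMatrix {Z : Type*} {n : ℕ} (α : Z → Z → ℝ) (lam : Z → ℝ)
    (μ : Z → Fin n → ℝ) (x y : Z × (Fin n → ℕ)) : ℝ :=
  if x = y then -exitRate (jsqJumpRate α lam μ) x else jsqJumpRate α lam μ x y

/-- The total service rate `μ_{iΣ}` in state `i`. -/
def totalService {Z : Type*} {n : ℕ} (μ : Z → Fin n → ℝ) (i : Z) : ℝ := ∑ j, μ i j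

/-- The long-run total service rate `μ_Σ = ∑_j E[μ_{ij}]`. -/
noncomputable def meanTotalService {Z : Type*} {n : ℕ} (p : PMF Z) (μ : Z → Fin n → ℝ) : ℝ :=
  ∑ j, expect p fun i => μ i j

/-- The mean load `ρ = λ / μ_Σ`. -/
noncomputable def meanLoad {Z : Type*} {n : ℕ} (p : PMF Z) (lam : Z → ℝ)
    (μ : Z → Fin n → ℝ) : ℝ :=
  expect p lam / meanTotalService p μ

/-- The state space collapse load condition: `λ_i > μ_{iΣ} - n * min_j μ_{ij}` for all `i`. -/
def SSCLoadCondition {Z : Type*} {n : ℕ} (lam : Z → ℝ) (μ : Z → Fin n → ℝ) : Prop :=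
  ∀ i, totalService μ i - n * (⨅ j, μ i j) < lam i

/-- `h(i) = μ_{iΣ} - λ_i`. -/
def hFun {Z : Type*} {n : ℕ} (lam : Z → ℝ) (μ : Z → Fin n → ℝ) (i : Z) : ℝ :=
  totalService μ i - lam i

/-- `k(i) = (μ_{iΣ} - λ_i) * V_h(i)`. -/
def kFun {Z : Type*} {n : ℕ} (lam : Z → ℝ) (μ : Z → Fin n → ℝ) (Vh : Z → ℝ) (i : Z) : ℝ :=
  (totalService μ i - lam i) * Vh i

/-! ### Expectations under a discrete law -/

/-! Put `b = exp (-s ε / n)`, `T = b ^ q_Σ`, `m = μ_Σ`, and let `I` be the total service rate of the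
empty queues. An arrival multiplies `T` by `b` and a departure by `b⁻¹`, so stationarity gives `E[T
(μ_{iΣ} - I - b λ_i)] = 0`, that is, `b E[T h] + (1 - b) E[T ℓ] = E[T I]`. Letting `b → 1` also
gives `E[I] = E[h] = ε m`.

The modulating state is averaged out with Poisson equations: stationarity against `T V_f` gives `E[T
f] = E[f] E[T] + (b⁻¹ - 1) E[T V_f (μ_{iΣ} - I - b λ_i)]` (`IsSteadyJSQ.expect_pow_mul`). For `f =
h` the correction contains `T V_h h = T k`, and the same identity is used once more for `k`, and for
`ℓ`. Up to errors, `E[T] (b ε m + (1 - b) (E[k] + m)) = ε m`; since `1 - b ≈ s ε / n`, division by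
`ε m` gives the limit (`IsSteadyJSQ.abs_transform_sub_le`, `abs_mul_sub_one_le_of_transform`).

The delicate errors are `E[T V_h I]` and `E[(1 - T) I]`. In the second, `I ≠ 0` forces an empty
queue, so `q_Σ` is at most `n` times the imbalance of the queues, and `1 - T ≤ (1 - b) q_Σ`. Both
reduce to `E[v I]` with a variable `v` that has a bounded moment of order `r = 1 + min 1 η`.
Truncating `v` at `K` gives `K ε m + O(K ^ (1 - r))`, and `K = ε ^ (-1/r)` yields the rate `ε ^ (1 -
1/r)`.

The moment of the imbalance `y` is state space collapse (`exists_imbalance_moment_bound`). The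
surplus in the load condition is positive in each state but perhaps not bounded away from `0`. By
affinity it dominates `λ^{(ε)} - λ^{(ε₀/2)}`, whose mean is of order `ε₀ m` and whose Poisson
equation is solved by `V_h^{(ε₀/2)} - V_h^{(ε)}`. Correcting the Lyapunov function `y ^ (r + 1)` by
this solution times `y ^ r` replaces the surplus by its mean. The powers are damped to be bounded,
so that no moment has to be known beforehand.

Uniformity in `ε` comes from interpolation: integrable Poisson solutions are unique up to constants,
so `V_h` is affine in `ε` and `k` quadratic, up to additive constants in `V_h`
(`exists_uniform_poisson`). -/

theorem PMF.hasSum_toReal {X : Type*} (p : PMF X) : HasSum (fun x => (p x).toReal) 1 := by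
  have h := ENNReal.hasSum_toReal (f := fun x => p x) (by rw [p.tsum_coe]; simp)
  rwa [← ENNReal.tsum_toReal_eq (fun x => p.apply_ne_top x), p.tsum_coe, ENNReal.toReal_one] at h

theorem HasFiniteMean.hasSum {X : Type*} {p : PMF X} {f : X → ℝ} (hf : HasFiniteMean p f) :
    HasSum (fun x => (p x).toReal * f x) (expect p f) :=
  Summable.hasSum hf

theorem HasFiniteMean.add {X : Type*} {p : PMF X} {f g : X → ℝ} (hf : HasFiniteMean p f)
    (hg : HasFiniteMean p g) : HasFiniteMean p fun x => f x + g x := by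
  simpa only [HasFiniteMean, mul_add] using Summable.add hf hg

theorem HasFiniteMean.sub {X : Type*} {p : PMF X} {f g : X → ℝ} (hf : HasFiniteMean p f)
    (hg : HasFiniteMean p g) : HasFiniteMean p fun x => f x - g x := by
  simpa only [HasFiniteMean, mul_sub] using Summable.sub hf hg

theorem HasFiniteMean.const_mul {X : Type*} {p : PMF X} {f : X → ℝ} (c : ℝ)
    (hf : HasFiniteMean p f) : HasFiniteMean p fun x => c * f x := by
  simpa only [HasFiniteMean, mul_left_comm] using Summable.mul_left c hf

theorem hasFiniteMean_const {X : Type*} {p : PMF X} (c : ℝ) : HasFiniteMean p fun _ => c :=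
  p.hasSum_toReal.summable.mul_right c

theorem HasFiniteMean.abs {X : Type*} {p : PMF X} {f : X → ℝ} (hf : HasFiniteMean p f) :
    HasFiniteMean p fun x => |f x| := by
  simpa only [HasFiniteMean, abs_mul, abs_of_nonneg ENNReal.toReal_nonneg] using Summable.abs hf

theorem HasFiniteMean.of_le {X : Type*} {p : PMF X} {f g : X → ℝ} (hg : HasFiniteMean p g)
    (h : ∀ x, |f x| ≤ g x) : HasFiniteMean p f := by
  refine Summable.of_norm_bounded hg fun x => ?_
  rw [Real.norm_eq_abs, abs_mul, abs_of_nonneg ENNReal.toReal_nonneg]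
  exact mul_le_mul_of_nonneg_left (h x) ENNReal.toReal_nonneg

theorem hasFiniteMean_of_bounded {X : Type*} {p : PMF X} {f : X → ℝ} {C : ℝ}
    (h : ∀ x, |f x| ≤ C) : HasFiniteMean p f :=
  (hasFiniteMean_const C).of_le h

theorem HasFiniteMean.bounded_mul {X : Type*} {p : PMF X} {f g : X → ℝ} {C : ℝ}
    (h : ∀ x, |f x| ≤ C) (hg : HasFiniteMean p g) : HasFiniteMean p fun x => f x * g x :=
  (hg.abs.const_mul C).of_le fun x => by
    rw [abs_mul]; exact mul_le_mul_of_nonneg_right (h x) (abs_nonneg _)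

theorem expect_add {X : Type*} {p : PMF X} {f g : X → ℝ} (hf : HasFiniteMean p f)
    (hg : HasFiniteMean p g) : expect p (fun x => f x + g x) = expect p f + expect p g := by
  simpa only [expect, mul_add] using Summable.tsum_add hf hg

theorem expect_sub {X : Type*} {p : PMF X} {f g : X → ℝ} (hf : HasFiniteMean p f)
    (hg : HasFiniteMean p g) : expect p (fun x => f x - g x) = expect p f - expect p g := by
  simpa only [expect, mul_sub] using Summable.tsum_sub hf hg

theorem expect_const_mul {X : Type*} {p : PMF X} {f : X → ℝ} (c : ℝ) :
    expect p (fun x => c * f x) = c * expect p f := by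
  simp only [expect, mul_left_comm _ c, tsum_mul_left]

theorem expect_const {X : Type*} {p : PMF X} (c : ℝ) : expect p (fun _ => c) = c := by
  simp only [expect, tsum_mul_right, p.hasSum_toReal.tsum_eq, one_mul]

theorem expect_mono {X : Type*} {p : PMF X} {f g : X → ℝ} (hf : HasFiniteMean p f)
    (hg : HasFiniteMean p g) (h : ∀ x, f x ≤ g x) : expect p f ≤ expect p g :=
  Summable.tsum_le_tsum (fun x => mul_le_mul_of_nonneg_left (h x) ENNReal.toReal_nonneg) hf hg

theorem expect_nonneg {X : Type*} {p : PMF X} {f : X → ℝ} (h : ∀ x, 0 ≤ f x) : 0 ≤ expect p f :=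
  tsum_nonneg fun x => mul_nonneg ENNReal.toReal_nonneg (h x)

theorem abs_expect_le {X : Type*} {p : PMF X} {f g : X → ℝ} (hg : HasFiniteMean p g)
    (h : ∀ x, |f x| ≤ g x) : |expect p f| ≤ expect p g := by
  have hf := hg.of_le h
  rw [abs_le]
  constructor
  · have := expect_mono (hg.const_mul (-1)) hf (fun x => by linarith [neg_abs_le (f x), h x])
    rw [expect_const_mul] at this
    linarith
  · exact expect_mono hf hg fun x => (le_abs_self _).trans (h x)

theorem abs_expect_le_of_bounded {X : Type*} {p : PMF X} {f : X → ℝ} {C : ℝ}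
    (h : ∀ x, |f x| ≤ C) : |expect p f| ≤ C := by
  simpa only [expect_const] using abs_expect_le (hasFiniteMean_const (p := p) C) h

theorem HasSum.of_eq {X : Type*} {f g : X → ℝ} {a b : ℝ} (h : HasSum f a)
    (hfg : ∀ x, g x = f x) (hab : b = a) : HasSum g b := by
  rw [hab, funext hfg]; exact h

/-! ### Stationary distributions of rate matrices -/

theorem hasSum_ne_iff {X : Type*} {f : X → ℝ} {x : X} {a : ℝ} :
    HasSum (fun y : {y // y ≠ x} => f y) a ↔ HasSum f (f x + a) := by
  classical
  have h1 : HasSum (fun y : {y // y ≠ x} => f y) a ↔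
      HasSum (({y | y ≠ x} : Set X).indicator f) a :=
    hasSum_subtype_iff_indicator (f := f) (s := {y | y ≠ x})
  have h2 : f = fun y => (if y = x then f x else 0) + ({y | y ≠ x} : Set X).indicator f y := by
    funext y
    by_cases h : y = x <;> simp [h]
  have h3 : HasSum (fun y => if y = x then f x else 0) (f x) := hasSum_ite_eq x (f x)
  rw [h1]
  constructor
  · intro h
    rw [h2]
    simpa using h3.add h
  · intro h
    have h4 := h.sub h3
    rw [add_sub_cancel_left] at h4
    refine h4.of_eq (fun y => ?_) rfl
    by_cases h : y = x <;> simp [h]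

theorem exitRate_nonneg {X : Type*} {G : X → X → ℝ} (hG : IsRateMatrix G) (x : X) :
    0 ≤ exitRate G x :=
  tsum_nonneg fun y => hG.nonneg x y y.2.symm

theorem IsRateMatrix.hasSum_row {X : Type*} {G : X → X → ℝ} (hG : IsRateMatrix G) (x : X) :
    HasSum (fun y => G x y) 0 := by
  have h := hasSum_ne_iff.1 (hG.summable x).hasSum
  have e : G x x + exitRate G x = 0 := by rw [hG.diag x]; ring
  rwa [← e]

/-- The expected drift of an integrable function vanishes in steady state. -/
theorem IsStationaryDist.hasSum_generator {X : Type*} {G : X → X → ℝ} {p : PMF X} {f : X → ℝ}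
    (hG : IsRateMatrix G) (hb : HasBoundedRates G) (hp : IsStationaryDist G p)
    (hf : HasFiniteMean p f) :
    (∀ x, p x ≠ 0 → Summable fun y => G x y * f y) ∧
      HasSum (fun x => (p x).toReal * ∑' y, G x y * f y) 0 := by
  classical
  obtain ⟨C, hC⟩ := hb
  -- In a column of `p G` only the diagonal entry is negative, so taking absolute values adds twice
  -- its size to the sum `0`. With bounded exit rates this makes the double series absolutely
  -- summable, and the order of summation can be exchanged.
  have habs : ∀ y, HasSum (fun x => |(p x).toReal * G x y|)
      (0 + 2 * ((p y).toReal * exitRate G y)) := by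
    intro y
    have h := (hp y).add (hasSum_ite_eq y (2 * ((p y).toReal * exitRate G y)))
    refine h.of_eq (fun x => ?_) rfl
    by_cases h : x = y
    · subst h
      have h1 := mul_nonneg (ENNReal.toReal_nonneg (a := p x)) (exitRate_nonneg hG x)
      rw [if_pos rfl, hG.diag, mul_neg, abs_neg, abs_of_nonneg h1]
      ring
    · rw [if_neg h, add_zero,
        abs_of_nonneg (mul_nonneg ENNReal.toReal_nonneg (hG.nonneg x y h))]
  have hT : Summable fun z : X × X => (p z.2).toReal * G z.2 z.1 * f z.1 := by
    rw [← summable_abs_iff, summable_prod_of_nonneg (fun _ => abs_nonneg _)]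
    simp only [abs_mul _ (f _)]
    refine ⟨fun y => (habs y).summable.mul_right _, ?_⟩
    simp only [tsum_mul_right, (habs _).tsum_eq]
    refine Summable.of_nonneg_of_le (fun y => ?_) (fun y => ?_)
      ((hf.abs.const_mul (2 * C)))
    · have := exitRate_nonneg hG y
      positivity
    · have h1 := mul_le_mul_of_nonneg_left (hC y)
        (mul_nonneg (ENNReal.toReal_nonneg (a := p y)) (abs_nonneg (f y)))
      nlinarith
  have h0 : HasSum (fun z : X × X => (p z.2).toReal * G z.2 z.1 * f z.1) 0 := by
    have h1 := hT.hasSum.prod_fiberwise (g := fun _ => 0)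
      (fun y => by simpa using (hp y).mul_right (f y))
    rw [← h1.unique hasSum_zero]
    exact hT.hasSum
  have h1 := (Equiv.prodComm X X).hasSum_iff.2 h0
  have hs : ∀ x, Summable fun y => (p x).toReal * G x y * f y := fun x =>
    h1.summable.prod_factor x
  refine ⟨fun x hx => ?_, ?_⟩
  · have hx' : (p x).toReal ≠ 0 := (ENNReal.toReal_pos hx (p.apply_ne_top x)).ne'
    refine ((hs x).mul_left ((p x).toReal)⁻¹).congr fun y => ?_
    field_simp
  · have h2 := h1.prod_fiberwise (fun x => (hs x).hasSum)
    simpa only [mul_assoc, tsum_mul_left] using h2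

/-- The balance equation at `b` bounds the outflow `p b * exitRate G b` below by the inflow from any
single `a`, so positive mass spreads along transitions of positive rate. -/
theorem IsStationaryDist.pos {X : Type*} {G : X → X → ℝ} {p : PMF X}
    (hG : IsRateMatrix G) (hirr : IsIrreducibleChain G) (hp : IsStationaryDist G p) (x : X) :
    0 < (p x).toReal := by
  obtain ⟨x₀, hx₀⟩ := p.support_nonempty
  have h0 : 0 < (p x₀).toReal :=
    ENNReal.toReal_pos ((p.mem_support_iff x₀).1 hx₀) (p.apply_ne_top x₀)
  refine Relation.ReflTransGen.head_induction_on (motive := fun a _ => 0 < (p a).toReal → 0 < (p x).toReal)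
    (hirr x₀ x) (fun h => h) ?_ h0
  intro a b hab _ ih ha
  refine ih ?_
  have h : HasSum (fun c : {c // c ≠ b} => (p c).toReal * G c b)
      ((p b).toReal * exitRate G b) := by
    refine (hasSum_ne_iff (f := fun c => (p c).toReal * G c b)).2 ?_
    rw [hG.diag b, mul_neg, neg_add_cancel]
    exact hp b
  have h2 := le_hasSum h ⟨a, hab.1⟩ (fun c _ =>
    mul_nonneg ENNReal.toReal_nonneg (hG.nonneg c b c.2))
  have h3 : 0 < (p b).toReal * exitRate G b := lt_of_lt_of_le (mul_pos ha hab.2) h2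
  exact pos_of_mul_pos_left h3 (exitRate_nonneg hG b)

/-- An integrable harmonic function of an ergodic chain is constant. -/
theorem IsStationaryDist.harmonic_const {X : Type*} {G : X → X → ℝ} {p : PMF X} {u : X → ℝ}
    (hG : IsRateMatrix G) (hb : HasBoundedRates G) (hirr : IsIrreducibleChain G)
    (hp : IsStationaryDist G p) (hu : HasFiniteMean p u)
    (hharm : ∀ x, HasSum (fun y => G x y * u y) 0) (x y : X) : u x = u y := by
  suffices H : ∀ x y, u y ≤ u x from le_antisymm (H y x) (H x y)
  clear x y
  intro x₀ y₀
  -- The positive part is subharmonic. Its drift is nonnegative with mean zero, hence zero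
  -- everywhere, so `v` is harmonic too.
  set v : X → ℝ := fun y => max (u y - u x₀) 0 with hv
  have hv0 : ∀ y, 0 ≤ v y := fun y => le_max_right _ _
  have hvm : HasFiniteMean p v :=
    (hu.abs.add (hasFiniteMean_const |u x₀|)).of_le fun y => by
      rw [abs_of_nonneg (hv0 y)]
      refine max_le ?_ (by positivity)
      linarith [le_abs_self (u y), neg_abs_le (u x₀)]
  obtain ⟨hs, hz⟩ := hp.hasSum_generator hG hb hvm
  have hs' : ∀ x, Summable fun y => G x y * v y := fun x => hs x fun h => by
    have := hp.pos hG hirr x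
    simp [h] at this
  have hterm : ∀ x, v x = 0 → ∀ y, 0 ≤ G x y * v y := by
    intro x hx y
    by_cases h : x = y
    · rw [← h, hx, mul_zero]
    · exact mul_nonneg (hG.nonneg x y h) (hv0 y)
  have hge : ∀ x, 0 ≤ ∑' y, G x y * v y := by
    intro x
    by_cases hx : v x = 0
    · exact tsum_nonneg (hterm x hx)
    · have hx' : v x = u x - u x₀ := by
        rcases max_choice (u x - u x₀) 0 with h | h
        · exact h
        · exact absurd h hx
      have h1 : HasSum (fun y => G x y * (u y - u x₀)) 0 := by
        simpa [mul_sub] using (hharm x).sub ((hG.hasSum_row x).mul_right (u x₀))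
      refine hasSum_le (fun y => ?_) h1 (hs' x).hasSum
      by_cases h : x = y
      · rw [← h, hx']
      · exact mul_le_mul_of_nonneg_left (le_max_left _ _) (hG.nonneg x y h)
  have hzero : ∀ x, ∑' y, G x y * v y = 0 := by
    intro x
    have h1 := (hasSum_zero_iff_of_nonneg (fun x =>
      mul_nonneg (ENNReal.toReal_nonneg (a := p x)) (hge x))).1 hz
    have h2 := congrFun h1 x
    exact (mul_eq_zero.1 h2).resolve_left (hp.pos hG hirr x).ne'
  -- Where the nonnegative harmonic `v` vanishes, all terms of its drift are nonnegative and sum to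
  -- zero, so `v` vanishes at every neighbour. The zero at `x₀` therefore propagates by
  -- irreducibility.
  have hvz : v y₀ = 0 := by
    refine Relation.ReflTransGen.head_induction_on
      (motive := fun a _ => v a = 0 → v y₀ = 0) (hirr x₀ y₀) (fun h => h) ?_ (by simp [hv])
    intro a b hab _ ih ha
    refine ih ?_
    have h1 : HasSum (fun y => G a y * v y) 0 := by
      rw [← hzero a]; exact (hs' a).hasSum
    have h2 := congrFun ((hasSum_zero_iff_of_nonneg (hterm a ha)).1 h1) b
    exact (mul_eq_zero.1 h2).resolve_left hab.2.ne'
  have := le_max_left (u y₀ - u x₀) 0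
  have h2 : max (u y₀ - u x₀) 0 = 0 := hvz
  linarith

/-- The rate matrix of the time reversal of a stationary chain. -/
noncomputable def reversedRates {X : Type*} (G : X → X → ℝ) (p : PMF X) (x y : X) : ℝ :=
  (p y).toReal * G y x / (p x).toReal

/-- The density `p' / p` is integrable under `p` and harmonic for the time reversal with respect to
`p`, which is again an irreducible chain with bounded rates and stationary distribution `p`. It is
therefore constant, equal to `1` by total mass. -/
theorem IsStationaryDist.unique {X : Type*} {G : X → X → ℝ} {p p' : PMF X}
    (hG : IsRateMatrix G) (hb : HasBoundedRates G) (hirr : IsIrreducibleChain G)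
    (hp : IsStationaryDist G p) (hp' : IsStationaryDist G p') : p' = p := by
  have hpos := hp.pos hG hirr
  have hdiag : ∀ x, reversedRates G p x x = G x x := fun x => by
    rw [reversedRates, mul_div_assoc, mul_div_cancel₀ _ (hpos x).ne']
  have hin : ∀ x, HasSum (fun y : {y // y ≠ x} => reversedRates G p x y) (exitRate G x) := by
    intro x
    refine (hasSum_ne_iff (f := fun y => reversedRates G p x y)).2 ?_
    rw [hdiag, hG.diag, neg_add_cancel]
    have h := (hp x).div_const (p x).toReal
    rwa [zero_div] at h
  have hexit : ∀ x, exitRate (reversedRates G p) x = exitRate G x := fun x => (hin x).tsum_eq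
  have hR : IsRateMatrix (reversedRates G p) :=
    ⟨fun x y h => div_nonneg (mul_nonneg ENNReal.toReal_nonneg (hG.nonneg y x h.symm))
      ENNReal.toReal_nonneg, fun x => (hin x).summable, fun x => by rw [hdiag, hexit, hG.diag]⟩
  have hRb : HasBoundedRates (reversedRates G p) := by
    obtain ⟨C, hC⟩ := hb
    exact ⟨C, fun x => by rw [hexit]; exact hC x⟩
  have hRirr : IsIrreducibleChain (reversedRates G p) := by
    intro x y
    refine (Relation.reflTransGen_swap.1 ?_ : Relation.ReflTransGen _ x y)
    refine Relation.ReflTransGen.mono (fun a b hab => ?_) _ _ (hirr y x)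
    exact ⟨hab.1.symm, div_pos (mul_pos (hpos a) hab.2) (hpos b)⟩
  have hRp : IsStationaryDist (reversedRates G p) p := by
    intro y
    have h := (hG.hasSum_row y).mul_left (p y).toReal
    rw [mul_zero] at h
    refine h.of_eq (fun x => ?_) rfl
    rw [reversedRates, mul_div_cancel₀ _ (hpos x).ne']
  set u : X → ℝ := fun x => (p' x).toReal / (p x).toReal with hu
  have hpu : ∀ x, (p x).toReal * u x = (p' x).toReal := fun x => by
    rw [hu]; exact mul_div_cancel₀ _ (hpos x).ne'
  have hum : HasFiniteMean p u := by
    simpa only [HasFiniteMean, hpu] using p'.hasSum_toReal.summable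
  have hharm : ∀ x, HasSum (fun y => reversedRates G p x y * u y) 0 := by
    intro x
    have h := (hp' x).div_const (p x).toReal
    rw [zero_div] at h
    refine h.of_eq (fun y => ?_) rfl
    simp only [reversedRates, ← hpu y]
    ring
  have hc := hRp.harmonic_const hR hRb hRirr hum hharm
  have hu1 : ∀ x, u x = 1 := by
    intro x
    have h1 := p.hasSum_toReal.mul_right (u x)
    have h3 : ∀ y, (p y).toReal * u x = (p' y).toReal := fun y => by rw [← hpu y, hc x y]
    simp only [h3, one_mul] at h1
    exact h1.unique p'.hasSum_toReal
  refine PMF.ext fun x => ?_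
  have h := hpu x
  rw [hu1, mul_one] at h
  exact ((ENNReal.toReal_eq_toReal_iff' (p.apply_ne_top x) (p'.apply_ne_top x)).1 h).symm

/-! ### Marginal laws -/

theorem PMF.hasSum_map_fst {Z Q : Type*} (p : PMF (Z × Q)) (i : Z) :
    HasSum (fun q => (p (i, q)).toReal) (p.map Prod.fst i).toReal := by
  classical
  have h : p.map Prod.fst i = ∑' q, p (i, q) := by
    rw [PMF.map_apply, ENNReal.tsum_prod', tsum_eq_single i]
    · simp
    · intro i' hi'
      simp [hi'.symm]
  have h2 : ∑' q, p (i, q) ≠ ⊤ := h ▸ (p.map Prod.fst).apply_ne_top i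
  rw [h, ENNReal.tsum_toReal_eq (fun q => p.apply_ne_top _)]
  exact (ENNReal.summable_toReal h2).hasSum

theorem hasFiniteMean_fst {Z Q : Type*} {p : PMF (Z × Q)} {f : Z → ℝ}
    (hf : HasFiniteMean (p.map Prod.fst) f) : HasFiniteMean p fun x => f x.1 := by
  rw [HasFiniteMean, ← summable_abs_iff, summable_prod_of_nonneg (fun _ => abs_nonneg _)]
  simp only [abs_mul, abs_of_nonneg ENNReal.toReal_nonneg]
  refine ⟨fun i => (p.hasSum_map_fst i).summable.mul_right _, ?_⟩
  simp only [tsum_mul_right, (p.hasSum_map_fst _).tsum_eq]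
  exact hf.abs

theorem expect_fst {Z Q : Type*} {p : PMF (Z × Q)} {f : Z → ℝ}
    (hf : HasFiniteMean (p.map Prod.fst) f) :
    expect p (fun x => f x.1) = expect (p.map Prod.fst) f := by
  have h := (hasFiniteMean_fst hf).hasSum.prod_fiberwise
    (fun i => (p.hasSum_map_fst i).mul_right (f i))
  exact h.tsum_eq.symm

/-! ### The generator of the join-the-shortest-queue chain -/

theorem shortestQueues_nonempty {n : ℕ} [NeZero n] (q : Fin n → ℕ) :
    (shortestQueues q).Nonempty := by
  obtain ⟨j, _, hj⟩ := Finset.exists_min_image Finset.univ q Finset.univ_nonempty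
  exact ⟨j, by simpa [shortestQueues] using hj⟩

theorem jsqRoute_nonneg {n : ℕ} (q : Fin n → ℕ) (j : Fin n) : 0 ≤ jsqRoute q j := by
  unfold jsqRoute
  split_ifs <;> positivity

theorem sum_jsqRoute {n : ℕ} [NeZero n] (q : Fin n → ℕ) : ∑ j, jsqRoute q j = 1 := by
  have h : ((shortestQueues q).card : ℝ) ≠ 0 := by
    exact_mod_cast (shortestQueues_nonempty q).card_pos.ne'
  simp only [jsqRoute, Finset.sum_ite_mem, Finset.univ_inter, Finset.sum_const, nsmul_eq_mul]
  field_simp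

/-- The part of the generator of the chain (modulating state, queue lengths) that comes from the
arrivals and the departures. -/
noncomputable def queueDrift {Z : Type*} {n : ℕ} (lam : Z → ℝ) (μ : Z → Fin n → ℝ)
    (F : (Fin n → ℕ) → ℝ) (x : Z × (Fin n → ℕ)) : ℝ :=
  lam x.1 * ∑ j, jsqRoute x.2 j * (F (x.2 + Pi.single j 1) - F x.2) +
    ∑ j, (if x.2 j = 0 then 0 else μ x.1 j) * (F (x.2 - Pi.single j 1) - F x.2)

/-- The sum runs over all `y`, including `y = x`, where `jsqJumpRate` takes the value `α x.1 x.1`.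
This is why the hypothesis involves a full row of `α`. -/
theorem hasSum_jsqJumpRate {Z : Type*} {n : ℕ} (α : Z → Z → ℝ) (lam : Z → ℝ)
    (μ : Z → Fin n → ℝ) (x : Z × (Fin n → ℕ)) {f : Z × (Fin n → ℕ) → ℝ} {a : ℝ}
    (hf : HasSum (fun i => α x.1 i * f (i, x.2)) a) :
    HasSum (fun y => jsqJumpRate α lam μ x y * f y)
      (a + (lam x.1 * (∑ j, jsqRoute x.2 j * f (x.1, x.2 + Pi.single j 1)) +
        ∑ j, (if x.2 j = 0 then 0 else μ x.1 j) * f (x.1, x.2 - Pi.single j 1))) := by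
  classical
  have hA : HasSum (fun y : Z × (Fin n → ℕ) => if y.2 = x.2 then α x.1 y.1 * f y else 0) a := by
    have hinj : Function.Injective fun i : Z => (i, x.2) := fun i i' h => congrArg Prod.fst h
    refine (hinj.hasSum_iff ?_).1 (hf.of_eq (fun i => ?_) rfl)
    · rintro ⟨i, q⟩ hy
      refine if_neg fun h => hy ⟨i, ?_⟩
      exact Prod.ext rfl h.symm
    · simp
  have hB : ∀ j, HasSum (fun y : Z × (Fin n → ℕ) =>
      if y.1 = x.1 ∧ y.2 = x.2 + Pi.single j 1 then lam x.1 * jsqRoute x.2 j * f y else 0)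
      (lam x.1 * (jsqRoute x.2 j * f (x.1, x.2 + Pi.single j 1))) := by
    intro j
    refine (hasSum_ite_eq (x.1, x.2 + Pi.single j 1)
      (lam x.1 * (jsqRoute x.2 j * f (x.1, x.2 + Pi.single j 1)))).of_eq (fun y => ?_) rfl
    simp only [Prod.ext_iff]
    split_ifs with h
    · rw [show y = (x.1, x.2 + Pi.single j 1) from Prod.ext h.1 h.2, mul_assoc]
    · rfl
  have hC : ∀ j, HasSum (fun y : Z × (Fin n → ℕ) =>
      if y.1 = x.1 ∧ x.2 = y.2 + Pi.single j 1 then μ x.1 j * f y else 0)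
      ((if x.2 j = 0 then 0 else μ x.1 j) * f (x.1, x.2 - Pi.single j 1)) := by
    intro j
    by_cases hj : x.2 j = 0
    · rw [if_pos hj, zero_mul]
      refine hasSum_zero.of_eq (fun y => if_neg fun h => ?_) rfl
      have := congrFun h.2 j
      simp [hj] at this
    · rw [if_neg hj]
      refine (hasSum_ite_eq (x.1, x.2 - Pi.single j 1)
        (μ x.1 j * f (x.1, x.2 - Pi.single j 1))).of_eq (fun y => ?_) rfl
      have hle : (Pi.single j 1 : Fin n → ℕ) ≤ x.2 := by
        intro l
        by_cases hl : l = j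
        · subst hl; simp; omega
        · simp [hl]
      have hiff : (y.1 = x.1 ∧ x.2 = y.2 + Pi.single j 1) ↔ y = (x.1, x.2 - Pi.single j 1) := by
        rw [Prod.ext_iff]
        refine and_congr_right fun _ => ?_
        constructor
        · intro h; simp [h]
        · intro h; simp only at h; rw [h, tsub_add_cancel_of_le hle]
      simp only [hiff]
      split_ifs with h
      · rw [h]
      · rfl
  refine (hA.add ((hasSum_sum (s := Finset.univ) fun j _ => hB j).add
    (hasSum_sum (s := Finset.univ) fun j _ => hC j))).of_eq (fun y => ?_) ?_
  · unfold jsqJumpRate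
    by_cases h1 : y.1 = x.1
    · simp only [h1, true_and, if_true, add_mul, Finset.sum_mul, ite_mul, zero_mul]
    · simp only [h1, false_and, if_false, add_zero, Finset.sum_const_zero, ite_mul, zero_mul]
  · rw [Finset.mul_sum]

theorem jsqJumpRate_self {Z : Type*} {n : ℕ} (α : Z → Z → ℝ) (lam : Z → ℝ)
    (μ : Z → Fin n → ℝ) (x : Z × (Fin n → ℕ)) : jsqJumpRate α lam μ x x = α x.1 x.1 := by
  simp [jsqJumpRate]

theorem jsqJumpRate_nonneg {Z : Type*} {n : ℕ} {α : Z → Z → ℝ} (hα : IsRateMatrix α)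
    {lam : Z → ℝ} (hlam : ∀ i, 0 ≤ lam i) {μ : Z → Fin n → ℝ} (hμ : ∀ i j, 0 ≤ μ i j)
    {x y : Z × (Fin n → ℕ)} (hxy : x ≠ y) : 0 ≤ jsqJumpRate α lam μ x y := by
  unfold jsqJumpRate
  refine add_nonneg ?_ ?_
  · split_ifs with h
    · exact hα.nonneg _ _ fun h' => hxy (Prod.ext h' h.symm)
    · exact le_rfl
  · split_ifs
    · refine add_nonneg (Finset.sum_nonneg fun j _ => ?_) (Finset.sum_nonneg fun j _ => ?_)
      · split_ifs
        · exact mul_nonneg (hlam _) (jsqRoute_nonneg _ _)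
        · exact le_rfl
      · split_ifs
        · exact hμ _ _
        · exact le_rfl
    · exact le_rfl

theorem hasSum_jsqJumpRate_ne {Z : Type*} {n : ℕ} [NeZero n] {α : Z → Z → ℝ}
    (hα : IsRateMatrix α) (lam : Z → ℝ) (μ : Z → Fin n → ℝ) (x : Z × (Fin n → ℕ)) :
    HasSum (fun y : {y // y ≠ x} => jsqJumpRate α lam μ x y)
      (exitRate α x.1 + (lam x.1 + ∑ j, if x.2 j = 0 then 0 else μ x.1 j)) := by
  refine (hasSum_ne_iff (f := jsqJumpRate α lam μ x)).2 ?_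
  refine (hasSum_jsqJumpRate α lam μ x (f := fun _ => 1) (a := 0)
    (by simpa using hα.hasSum_row x.1)).of_eq (fun y => (mul_one _).symm) ?_
  simp only [mul_one, sum_jsqRoute, jsqJumpRate_self, hα.diag]
  ring

theorem exitRate_jsqRateMatrix {Z : Type*} {n : ℕ} (α : Z → Z → ℝ)
    (lam : Z → ℝ) (μ : Z → Fin n → ℝ) (x : Z × (Fin n → ℕ)) :
    exitRate (jsqRateMatrix α lam μ) x = exitRate (jsqJumpRate α lam μ) x :=
  tsum_congr fun y => if_neg y.2.symm

theorem isRateMatrix_jsqRateMatrix {Z : Type*} {n : ℕ} [NeZero n] {α : Z → Z → ℝ}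
    (hα : IsRateMatrix α) {lam : Z → ℝ} (hlam : ∀ i, 0 ≤ lam i) {μ : Z → Fin n → ℝ}
    (hμ : ∀ i j, 0 ≤ μ i j) : IsRateMatrix (jsqRateMatrix α lam μ) where
  nonneg x y h := by
    rw [jsqRateMatrix, if_neg h]
    exact jsqJumpRate_nonneg hα hlam hμ h
  summable x := (hasSum_jsqJumpRate_ne hα lam μ x).summable.congr fun y => by
    rw [jsqRateMatrix, if_neg y.2.symm]
  diag x := by rw [exitRate_jsqRateMatrix, jsqRateMatrix, if_pos rfl]

theorem hasBoundedRates_jsqRateMatrix {Z : Type*} {n : ℕ} [NeZero n] {α : Z → Z → ℝ}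
    (hα : IsRateMatrix α) (hb : HasBoundedRates α) {lam : Z → ℝ} {μ : Z → Fin n → ℝ}
    (hμ : ∀ i j, 0 ≤ μ i j) {L M : ℝ} (hL : ∀ i, lam i ≤ L) (hM : ∀ i j, μ i j ≤ M) :
    HasBoundedRates (jsqRateMatrix α lam μ) := by
  obtain ⟨C, hC⟩ := hb
  refine ⟨C + (L + ∑ _j : Fin n, M), fun x => ?_⟩
  rw [exitRate_jsqRateMatrix, exitRate, (hasSum_jsqJumpRate_ne hα lam μ x).tsum_eq]
  refine add_le_add (hC _) (add_le_add (hL _) (Finset.sum_le_sum fun j _ => ?_))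
  split_ifs
  · exact (hμ x.1 j).trans (hM _ _)
  · exact hM _ _

theorem hasSum_jsqRateMatrix {Z : Type*} {n : ℕ} [NeZero n] {α : Z → Z → ℝ}
    (hα : IsRateMatrix α) (lam : Z → ℝ) (μ : Z → Fin n → ℝ) (x : Z × (Fin n → ℕ))
    {V : Z → ℝ} {a : ℝ} (F : (Fin n → ℕ) → ℝ) (hV : HasSum (fun i => α x.1 i * V i) a) :
    HasSum (fun y => jsqRateMatrix α lam μ x y * (F y.2 * V y.1))
      (F x.2 * a + V x.1 * queueDrift lam μ F x) := by
  classical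
  have h1 := hasSum_jsqJumpRate α lam μ x (f := fun y => F y.2 * V y.1) (a := F x.2 * a)
    ((hV.mul_left (F x.2)).of_eq (fun i => by ring) rfl)
  -- The diagonal of `jsqJumpRate` already carries the exit rate of the modulating chain. Only the
  -- arrival and departure rates are still missing from the diagonal of the generator.
  have h2 := hasSum_ite_eq x (-(lam x.1 + ∑ j, if x.2 j = 0 then 0 else μ x.1 j) *
    (F x.2 * V x.1))
  refine (h1.add h2).of_eq (fun y => ?_) ?_
  · by_cases h : x = y
    · subst h
      rw [jsqRateMatrix, if_pos rfl, if_pos rfl, exitRate,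
        (hasSum_jsqJumpRate_ne hα lam μ x).tsum_eq, jsqJumpRate_self, hα.diag]
      ring
    · rw [jsqRateMatrix, if_neg h, if_neg (Ne.symm h), add_zero]
  · have h3 : ∑ j, jsqRoute x.2 j * (F (x.2 + Pi.single j 1) - F x.2) =
        ∑ j, jsqRoute x.2 j * F (x.2 + Pi.single j 1) - F x.2 := by
      simp only [mul_sub, Finset.sum_sub_distrib, ← Finset.sum_mul, sum_jsqRoute, one_mul]
    rw [queueDrift, h3]
    simp only [mul_sub, Finset.sum_sub_distrib, ← Finset.sum_mul, ← mul_assoc]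
    ring

theorem IsStationaryDist.hasSum_jsq {Z : Type*} {n : ℕ} [NeZero n] {α : Z → Z → ℝ}
    (hα : IsRateMatrix α) (hb : HasBoundedRates α) {lam : Z → ℝ} (hlam : ∀ i, 0 ≤ lam i)
    {L M : ℝ} (hL : ∀ i, lam i ≤ L) {μ : Z → Fin n → ℝ} (hμ : ∀ i j, 0 ≤ μ i j)
    (hM : ∀ i j, μ i j ≤ M) {p : PMF (Z × (Fin n → ℕ))}
    (hp : IsStationaryDist (jsqRateMatrix α lam μ) p) {F : (Fin n → ℕ) → ℝ} {V g : Z → ℝ}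
    (hV : ∀ i, HasSum (fun i' => α i i' * V i') (g i))
    (hFV : HasFiniteMean p fun x => F x.2 * V x.1) :
    HasSum (fun x => (p x).toReal * (F x.2 * g x.1 + V x.1 * queueDrift lam μ F x)) 0 := by
  have h := (hp.hasSum_generator (isRateMatrix_jsqRateMatrix hα hlam hμ)
    (hasBoundedRates_jsqRateMatrix hα hb hμ hL hM) hFV).2
  refine h.of_eq (fun x => ?_) rfl
  rw [(hasSum_jsqRateMatrix hα lam μ x F (hV x.1)).tsum_eq]

/-- The queues do not influence the modulating chain, so testing against the indicator of a
modulating state leaves the balance equation of `α`. With uniqueness, this identifies the first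
marginal of `p` with `stat`. -/
theorem IsStationaryDist.map_fst {Z : Type*} {n : ℕ} [NeZero n] {α : Z → Z → ℝ}
    (hα : IsRateMatrix α) (hb : HasBoundedRates α) {lam : Z → ℝ} (hlam : ∀ i, 0 ≤ lam i)
    {L M : ℝ} (hL : ∀ i, lam i ≤ L) {μ : Z → Fin n → ℝ} (hμ : ∀ i j, 0 ≤ μ i j)
    (hM : ∀ i j, μ i j ≤ M) {p : PMF (Z × (Fin n → ℕ))}
    (hp : IsStationaryDist (jsqRateMatrix α lam μ) p) :
    IsStationaryDist α (p.map Prod.fst) := by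
  classical
  intro k
  have h := hp.hasSum_jsq hα hb hlam hL hμ hM (F := fun _ => 1)
    (V := fun i => if i = k then 1 else 0) (g := fun i => α i k)
    (fun i => (hasSum_ite_eq k (α i k)).of_eq (fun i' => by
      by_cases h : i' = k <;> simp [h]) rfl)
    (hasFiniteMean_of_bounded (C := 1) fun x => by split_ifs <;> simp)
  have h' : HasSum (fun x : Z × (Fin n → ℕ) => (p x).toReal * α x.1 k) 0 :=
    h.of_eq (fun x => by simp [queueDrift]) rfl
  exact h'.prod_fiberwise fun i => (p.hasSum_map_fst i).mul_right (α i k)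

theorem IsPoissonSolution.hasSum {Z : Type*} {α : Z → Z → ℝ} (hα : IsRateMatrix α) {p : PMF Z}
    {f V : Z → ℝ} (h : IsPoissonSolution α p f V) (i : Z) :
    HasSum (fun i' => α i i' * V i') (expect p f - f i) := by
  have h1 := (hasSum_ne_iff (f := fun i' => α i i' * V i')).1 (h.2 i).1.hasSum
  refine h1.of_eq (fun _ => rfl) ?_
  have h2 := (h.2 i).2
  rw [hα.diag]
  linarith

/-- A join-the-shortest-queue system in steady state: an ergodic modulating chain with rates `α`
and stationary distribution `stat`, arrival and service rates bounded by `M`, and a stationary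
distribution `p` of the whole chain. -/
structure IsSteadyJSQ {Z : Type*} {n : ℕ} (α : Z → Z → ℝ) (stat : PMF Z) (lam : Z → ℝ)
    (μ : Z → Fin n → ℝ) (M : ℝ) (p : PMF (Z × (Fin n → ℕ))) : Prop where
  rate : IsRateMatrix α
  bdd : HasBoundedRates α
  irr : IsIrreducibleChain α
  stat : IsStationaryDist α stat
  lam_nonneg : ∀ i, 0 ≤ lam i
  lam_le : ∀ i, lam i ≤ M
  mu_nonneg : ∀ i j, 0 ≤ μ i j
  mu_le : ∀ i j, μ i j ≤ M
  steady : IsStationaryDist (jsqRateMatrix α lam μ) p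

/-- The total service rate of the servers that have no jobs. -/
def idleService {Z : Type*} {n : ℕ} (μ : Z → Fin n → ℝ) (x : Z × (Fin n → ℕ)) : ℝ :=
  ∑ j, if x.2 j = 0 then μ x.1 j else 0

theorem totalService_nonneg {Z : Type*} {n : ℕ} {μ : Z → Fin n → ℝ} (hμ : ∀ i j, 0 ≤ μ i j)
    (i : Z) : 0 ≤ totalService μ i :=
  Finset.sum_nonneg fun j _ => hμ i j

theorem totalService_le {Z : Type*} {n : ℕ} {μ : Z → Fin n → ℝ} {M : ℝ}
    (hM : ∀ i j, μ i j ≤ M) (i : Z) : totalService μ i ≤ n * M := by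
  simpa [totalService] using Finset.sum_le_sum (s := Finset.univ) fun j _ => hM i j

theorem idleService_nonneg {Z : Type*} {n : ℕ} {μ : Z → Fin n → ℝ} (hμ : ∀ i j, 0 ≤ μ i j)
    (x : Z × (Fin n → ℕ)) : 0 ≤ idleService μ x :=
  Finset.sum_nonneg fun j _ => by split_ifs; exacts [hμ _ _, le_rfl]

theorem idleService_le {Z : Type*} {n : ℕ} {μ : Z → Fin n → ℝ} (hμ : ∀ i j, 0 ≤ μ i j)
    (x : Z × (Fin n → ℕ)) : idleService μ x ≤ totalService μ x.1 :=
  Finset.sum_le_sum fun j _ => by split_ifs; exacts [le_rfl, hμ _ _]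

theorem meanTotalService_eq {Z : Type*} {n : ℕ} {stat : PMF Z} {μ : Z → Fin n → ℝ} {M : ℝ}
    (hμ : ∀ i j, 0 ≤ μ i j) (hM : ∀ i j, μ i j ≤ M) :
    meanTotalService stat μ = expect stat (totalService μ) := by
  have h : ∀ j, HasFiniteMean stat fun i => μ i j := fun j =>
    hasFiniteMean_of_bounded (C := M) fun i => by rw [abs_of_nonneg (hμ i j)]; exact hM i j
  have h2 := hasSum_sum (s := Finset.univ) fun j _ => (h j).hasSum
  rw [meanTotalService, ← h2.tsum_eq, expect]
  simp only [totalService, Finset.mul_sum]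

/-! ### Steady-state identities for geometric test functions of the total queue length -/

section Queue

variable {Z : Type*} {n : ℕ} {α : Z → Z → ℝ} {stat : PMF Z} {lam : Z → ℝ}
  {μ : Z → Fin n → ℝ} {M : ℝ} {p : PMF (Z × (Fin n → ℕ))}

theorem IsSteadyJSQ.map_fst_eq [NeZero n] (H : IsSteadyJSQ α stat lam μ M p) :
    p.map Prod.fst = stat :=
  H.stat.unique H.rate H.bdd H.irr
    (H.steady.map_fst H.rate H.bdd H.lam_nonneg H.lam_le H.mu_nonneg H.mu_le)

theorem IsSteadyJSQ.hasFiniteMean_fst [NeZero n] (H : IsSteadyJSQ α stat lam μ M p) {f : Z → ℝ}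
    (hf : HasFiniteMean stat f) : HasFiniteMean p fun x => f x.1 :=
  _root_.hasFiniteMean_fst (by rwa [H.map_fst_eq])

theorem IsSteadyJSQ.expect_fst [NeZero n] (H : IsSteadyJSQ α stat lam μ M p) {f : Z → ℝ}
    (hf : HasFiniteMean stat f) : expect p (fun x => f x.1) = expect stat f := by
  rw [_root_.expect_fst (by rwa [H.map_fst_eq]), H.map_fst_eq]

theorem IsSteadyJSQ.drift_eq [NeZero n] (H : IsSteadyJSQ α stat lam μ M p)
    {F : (Fin n → ℕ) → ℝ} {V g : Z → ℝ} (hV : ∀ i, HasSum (fun i' => α i i' * V i') (g i))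
    (hFV : HasFiniteMean p fun x => F x.2 * V x.1) :
    HasSum (fun x => (p x).toReal * (F x.2 * g x.1 + V x.1 * queueDrift lam μ F x)) 0 :=
  H.steady.hasSum_jsq H.rate H.bdd H.lam_nonneg H.lam_le H.mu_nonneg H.mu_le hV hFV

/-- The total rate of service in progress minus `b` times the arrival rate. -/
def netService (lam : Z → ℝ) (μ : Z → Fin n → ℝ) (b : ℝ) (x : Z × (Fin n → ℕ)) : ℝ :=
  totalService μ x.1 - idleService μ x - b * lam x.1

/-- Every arrival multiplies the test function by `b`, whichever queue it joins, and every departure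
by `b⁻¹`. Since `b - 1 = -(b⁻¹ - 1) * b`, arrivals enter with weight `b`, hence the form of
`netService`. -/
theorem queueDrift_pow [NeZero n] {b : ℝ} (hb : b ≠ 0) (x : Z × (Fin n → ℕ)) :
    queueDrift lam μ (fun q => b ^ (∑ j, q j)) x =
      (b⁻¹ - 1) * (b ^ (∑ j, x.2 j) * netService lam μ b x) := by
  have h1 : ∀ j, ∑ l, (x.2 + Pi.single j 1 : Fin n → ℕ) l = (∑ l, x.2 l) + 1 := fun j => by
    simp [Finset.sum_add_distrib]
  have h2 : ∀ j, (if x.2 j = 0 then 0 else μ x.1 j) *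
      (b ^ (∑ l, (x.2 - Pi.single j 1 : Fin n → ℕ) l) - b ^ (∑ l, x.2 l)) =
      (μ x.1 j - if x.2 j = 0 then μ x.1 j else 0) * ((b⁻¹ - 1) * b ^ (∑ l, x.2 l)) := by
    intro j
    by_cases hj : x.2 j = 0
    · simp [hj]
    · have hle : (Pi.single j 1 : Fin n → ℕ) ≤ x.2 := by
        intro l
        by_cases hl : l = j
        · subst hl; simp; omega
        · simp [hl]
      have h3 : ∑ l, x.2 l = (∑ l, (x.2 - Pi.single j 1 : Fin n → ℕ) l) + 1 := by
        conv_lhs => rw [← tsub_add_cancel_of_le hle]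
        simp [Finset.sum_add_distrib]
      rw [if_neg hj, if_neg hj, h3, pow_succ]
      field_simp
      ring
  simp only [queueDrift, h1, h2, ← Finset.sum_mul, sum_jsqRoute, Finset.sum_sub_distrib,
    netService, totalService, idleService, pow_succ]
  field_simp
  ring

theorem IsSteadyJSQ.abs_netService_le [NeZero n] (H : IsSteadyJSQ α stat lam μ M p) {b : ℝ}
    (hb0 : 0 ≤ b) (hb1 : b ≤ 1) (x : Z × (Fin n → ℕ)) :
    |netService lam μ b x| ≤ n * M + M := by
  have h1 := totalService_le H.mu_le x.1
  have h2 := idleService_nonneg H.mu_nonneg x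
  have h3 := idleService_le H.mu_nonneg x
  have h4 := H.lam_nonneg x.1
  have h5 := H.lam_le x.1
  have h6 : b * lam x.1 ≤ 1 * lam x.1 := mul_le_mul_of_nonneg_right hb1 h4
  have h7 : 0 ≤ b * lam x.1 := mul_nonneg hb0 h4
  have h8 := totalService_nonneg H.mu_nonneg x.1
  rw [abs_le, netService]
  constructor <;> linarith

theorem abs_pow_le_one_of_le {b : ℝ} (hb0 : 0 ≤ b) (hb1 : b ≤ 1) (k : ℕ) : |b ^ k| ≤ 1 := by
  rw [abs_of_nonneg (pow_nonneg hb0 _)]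
  exact pow_le_one₀ hb0 hb1

theorem IsSteadyJSQ.hasFiniteMean_netService [NeZero n] (H : IsSteadyJSQ α stat lam μ M p)
    {b : ℝ} (hb0 : 0 ≤ b) (hb1 : b ≤ 1) {V : Z → ℝ} (hV : HasFiniteMean stat V) :
    HasFiniteMean p fun x => b ^ (∑ j, x.2 j) * (V x.1 * netService lam μ b x) := by
  refine HasFiniteMean.bounded_mul (fun x => abs_pow_le_one_of_le hb0 hb1 _) ?_
  simp only [mul_comm (V _)]
  exact HasFiniteMean.bounded_mul (H.abs_netService_le hb0 hb1) (H.hasFiniteMean_fst hV)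

/-- Averaging over the modulating chain by means of a solution to the Poisson equation. -/
theorem IsSteadyJSQ.expect_pow_mul [NeZero n] (H : IsSteadyJSQ α stat lam μ M p) {b : ℝ}
    (hb0 : 0 < b) (hb1 : b ≤ 1) {f V : Z → ℝ} (hf : IsPoissonSolution α stat f V)
    (hV : HasFiniteMean stat V) :
    expect p (fun x => b ^ (∑ j, x.2 j) * f x.1) =
      expect stat f * expect p (fun x => b ^ (∑ j, x.2 j)) + (b⁻¹ - 1) *
        expect p (fun x => b ^ (∑ j, x.2 j) * (V x.1 * netService lam μ b x)) := by
  have hbd : ∀ x : Z × (Fin n → ℕ), |b ^ (∑ j, x.2 j)| ≤ 1 :=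
    fun x => abs_pow_le_one_of_le hb0.le hb1 _
  have h := H.drift_eq (F := fun q => b ^ (∑ j, q j)) (fun i => hf.hasSum H.rate i)
    (HasFiniteMean.bounded_mul hbd (H.hasFiniteMean_fst hV))
  have hψ : HasFiniteMean p fun x : Z × (Fin n → ℕ) => b ^ (∑ j, x.2 j) :=
    hasFiniteMean_of_bounded hbd
  have hψf : HasFiniteMean p fun x : Z × (Fin n → ℕ) => b ^ (∑ j, x.2 j) * f x.1 :=
    HasFiniteMean.bounded_mul hbd (H.hasFiniteMean_fst hf.1)
  have hN := H.hasFiniteMean_netService hb0.le hb1 hV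
  have h2 := (((hψ.const_mul (expect stat f)).sub hψf).add (hN.const_mul (b⁻¹ - 1))).hasSum
  have h3 := h2.unique (h.of_eq (fun x => by simp only [queueDrift_pow hb0.ne']; ring) rfl)
  rw [expect_add ((hψ.const_mul _).sub hψf) (hN.const_mul _), expect_sub (hψ.const_mul _) hψf,
    expect_const_mul, expect_const_mul] at h3
  linarith

theorem IsSteadyJSQ.expect_pow_mul_netService [NeZero n] (H : IsSteadyJSQ α stat lam μ M p)
    {b : ℝ} (hb0 : 0 < b) (hb1 : b < 1) :
    expect p (fun x => b ^ (∑ j, x.2 j) * netService lam μ b x) = 0 := by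
  have h := H.drift_eq (F := fun q => b ^ (∑ j, q j)) (V := fun _ => 1) (g := fun _ => 0)
    (fun i => by simpa using H.rate.hasSum_row i)
    (hasFiniteMean_of_bounded (C := 1) fun x => by
      rw [mul_one]; exact abs_pow_le_one_of_le hb0.le hb1.le _)
  have hτ : b⁻¹ - 1 ≠ 0 := by
    have := (one_lt_inv₀ hb0).2 hb1
    linarith
  have h2 : HasSum (fun x => (p x).toReal * (b ^ (∑ j, x.2 j) * netService lam μ b x)) 0 := by
    refine (h.mul_left (b⁻¹ - 1)⁻¹).of_eq (fun x => ?_) (by simp)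
    rw [queueDrift_pow hb0.ne', mul_zero, zero_add, one_mul, mul_left_comm _ (b⁻¹ - 1),
      inv_mul_cancel_left₀ hτ]
  exact h2.tsum_eq

/-- This is the balance of arrivals and departures. The test function `q_Σ` itself is not known to
be integrable, so the identity is obtained as the limit `b → 1` of the bounded ones. -/
theorem IsSteadyJSQ.expect_netService_one [NeZero n] (H : IsSteadyJSQ α stat lam μ M p) :
    expect p (netService lam μ 1) = 0 := by
  set b : ℕ → ℝ := fun k => 1 - 1 / ((k : ℝ) + 2) with hb
  have hb1 : ∀ k, b k < 1 := fun k => by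
    have : (0 : ℝ) < 1 / ((k : ℝ) + 2) := by positivity
    simp only [hb]; linarith
  have hb0 : ∀ k, 0 < b k := fun k => by
    have : 1 / ((k : ℝ) + 2) < 1 := by
      rw [div_lt_one (by positivity)]
      have : (0 : ℝ) ≤ k := k.cast_nonneg
      linarith
    simp only [hb]; linarith
  have hbt : Tendsto b atTop (𝓝 1) := by
    have h : Tendsto (fun k : ℕ => 1 / ((k : ℝ) + 2)) atTop (𝓝 0) := by
      simp only [one_div]
      exact (tendsto_natCast_atTop_atTop.atTop_add tendsto_const_nhds).inv_tendsto_atTop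
    simpa [hb] using h.const_sub 1
  have hlim : Tendsto (fun k => expect p fun x => b k ^ (∑ j, x.2 j) * netService lam μ (b k) x)
      atTop (𝓝 (expect p (netService lam μ 1))) := by
    refine tendsto_tsum_of_dominated_convergence
      (bound := fun x => (p x).toReal * (n * M + M))
      (p.hasSum_toReal.summable.mul_right _) (fun x => ?_) (Eventually.of_forall fun k x => ?_)
    · have h1 := (hbt.pow (∑ j, x.2 j)).mul ((hbt.mul_const (lam x.1)).const_sub
        (totalService μ x.1 - idleService μ x))
      simpa [netService] using h1.const_mul (p x).toReal
    · rw [Real.norm_eq_abs, abs_mul, abs_mul, abs_of_nonneg ENNReal.toReal_nonneg]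
      refine mul_le_mul_of_nonneg_left ?_ ENNReal.toReal_nonneg
      have h1 := abs_pow_le_one_of_le (hb0 k).le (hb1 k).le (∑ j, x.2 j)
      have h2 := H.abs_netService_le (hb0 k).le (hb1 k).le x
      calc _ ≤ 1 * |netService lam μ (b k) x| :=
            mul_le_mul_of_nonneg_right h1 (abs_nonneg _)
        _ ≤ _ := by rwa [one_mul]
  refine tendsto_nhds_unique hlim ?_
  simp only [H.expect_pow_mul_netService (hb0 _) (hb1 _)]
  exact tendsto_const_nhds

end Queue

/-! ### Truncated powers -/

/-- With `ρ = x' / x`, the power `ρ ^ c` is the geometric mean of `ρ` and `ρ ^ 2` with weights `2 -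
c` and `c - 1`. The arithmetic mean expanded at `ρ = 1` is `1 + c (ρ - 1) + (c - 1) (ρ - 1) ^ 2`. -/
theorem rpow_le_quadratic {x x' c : ℝ} (hx : 0 < x) (hx' : 0 < x') (hc1 : 1 ≤ c) (hc2 : c ≤ 2) :
    x' ^ c ≤ x ^ c + x ^ (c - 1) * (c * (x' - x) + (c - 1) * ((x' - x) ^ 2 / x)) := by
  have hρ : 0 < x' / x := div_pos hx' hx
  have h := Real.geom_mean_le_arith_mean2_weighted (w₁ := 2 - c) (w₂ := c - 1)
    (p₁ := x' / x) (p₂ := (x' / x) ^ (2 : ℝ)) (by linarith) (by linarith) hρ.le (by positivity)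
    (by ring)
  rw [← Real.rpow_mul hρ.le, ← Real.rpow_add hρ, show 2 - c + 2 * (c - 1) = c by ring,
    Real.div_rpow hx'.le hx.le, Real.rpow_two] at h
  have hxc : 0 < x ^ c := Real.rpow_pos_of_pos hx c
  rw [div_le_iff₀ hxc] at h
  refine h.trans (le_of_eq ?_)
  rw [Real.rpow_sub_one hx.ne']
  field_simp
  ring

theorem abs_rpow_sub_rpow_le {y y' r : ℝ} (hy : 1 ≤ y) (hy' : 1 ≤ y') (hyy : |y' - y| ≤ 3)
    (hr1 : 1 ≤ r) (hr2 : r ≤ 2) : |y' ^ r - y ^ r| ≤ 15 * y ^ (r - 1) := by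
  have hy0 : 0 < y := by linarith
  have hy0' : 0 < y' := by linarith
  have hp : 0 < y ^ (r - 1) := Real.rpow_pos_of_pos hy0 _
  obtain ⟨ha, hb⟩ := abs_le.1 hyy
  rw [abs_le]
  constructor
  · have h := one_add_mul_self_le_rpow_one_add (s := (y' - y) / y) (by
      rw [le_div_iff₀ hy0]; linarith) hr1
    rw [show 1 + (y' - y) / y = y' / y by field_simp; ring, Real.div_rpow hy0'.le hy0.le,
      le_div_iff₀ (Real.rpow_pos_of_pos hy0 r)] at h
    have h2 : (1 + r * ((y' - y) / y)) * y ^ r = y ^ r + r * (y' - y) * y ^ (r - 1) := by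
      rw [Real.rpow_sub_one hy0.ne']; field_simp
    rw [h2] at h
    have h3 : -15 ≤ r * (y' - y) := by nlinarith
    nlinarith
  · have h := rpow_le_quadratic hy0 hy0' hr1 hr2
    have h1 : (y' - y) ^ 2 / y ≤ 9 := by
      rw [div_le_iff₀ hy0]; nlinarith
    have h0 : 0 ≤ (y' - y) ^ 2 / y := by positivity
    have h2 : r * (y' - y) + (r - 1) * ((y' - y) ^ 2 / y) ≤ 15 := by nlinarith
    nlinarith

/-- The power `y ^ r`, damped by a factor that makes it bounded. -/
noncomputable def tamePow (d r y : ℝ) : ℝ := y ^ r / (1 + d * y ^ (r + 1)) ^ 2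

/-- The power `y ^ (r - 1)` with the damping factor of `tamePow`. -/
noncomputable def tameWeight (d r y : ℝ) : ℝ := y ^ (r - 1) / (1 + d * y ^ (r + 1)) ^ 2

/-- A bounded concave function of `y ^ (r + 1)`. -/
noncomputable def tameTest (d r y : ℝ) : ℝ := y ^ (r + 1) / (1 + d * y ^ (r + 1))

theorem tameWeight_nonneg {d r y : ℝ} (hy : 1 ≤ y) : 0 ≤ tameWeight d r y :=
  div_nonneg (Real.rpow_nonneg (by linarith) _) (sq_nonneg _)

theorem tamePow_eq {d r y : ℝ} (hy : 1 ≤ y) : tamePow d r y = y * tameWeight d r y := by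
  rw [tamePow, tameWeight, Real.rpow_sub_one (by linarith)]
  field_simp

theorem tamePow_nonneg {d r y : ℝ} (hy : 1 ≤ y) : 0 ≤ tamePow d r y :=
  div_nonneg (Real.rpow_nonneg (by linarith) _) (sq_nonneg _)

theorem abs_tameTest_le {d r y : ℝ} (hd : 0 < d) (hy : 1 ≤ y) : |tameTest d r y| ≤ 1 / d := by
  have h : 0 ≤ y ^ (r + 1) := Real.rpow_nonneg (by linarith) _
  rw [tameTest, abs_of_nonneg (by positivity), div_le_div_iff₀ (by positivity) hd]
  linarith

theorem tamePow_le {d r y : ℝ} (hd : 0 < d) (hy : 1 ≤ y) : tamePow d r y ≤ 1 / d := by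
  have hy0 : 0 < y := by linarith
  have h : 0 ≤ y ^ r := Real.rpow_nonneg hy0.le _
  rw [tamePow, Real.rpow_add_one hy0.ne', div_le_div_iff₀ (by positivity) hd]
  have h2 : y ^ r * d ≤ d * (y ^ r * y) := by
    nlinarith [mul_nonneg h hd.le]
  nlinarith [sq_nonneg (d * (y ^ r * y)), mul_nonneg h hd.le]

/-- Concavity of `T / (1 + d T)` bounds the increment by its tangent, whose slope `1 / (1 + d T) ^
2` is the damping in `tameWeight`. The increment is expressed through `y ^ 2` because the jumps of
the squared imbalance are explicit; `9` is the square of the factor `3` in `hyy`. -/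
theorem tameTest_sub_le {d r y y' : ℝ} (hd : 0 < d) (hy : 1 ≤ y) (hy' : 1 ≤ y')
    (hyy : |y' ^ 2 - y ^ 2| ≤ 3 * y) (hr1 : 1 ≤ r) (hr2 : r ≤ 2) :
    tameTest d r y' - tameTest d r y ≤
      tameWeight d r y * ((r + 1) / 2 * (y' ^ 2 - y ^ 2) + 9) := by
  have hy0 : 0 < y := by linarith
  have hy0' : 0 < y' := by linarith
  have hT : 0 < y ^ (r + 1) := Real.rpow_pos_of_pos hy0 _
  have hT' : 0 < y' ^ (r + 1) := Real.rpow_pos_of_pos hy0' _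
  have key : y' ^ (r + 1) - y ^ (r + 1) ≤
      y ^ (r - 1) * ((r + 1) / 2 * (y' ^ 2 - y ^ 2) + 9) := by
    have h := rpow_le_quadratic (x := y ^ 2) (x' := y' ^ 2) (c := (r + 1) / 2) (by positivity)
      (by positivity) (by linarith) (by linarith)
    have e : ∀ z b : ℝ, 0 < z → (z ^ 2) ^ b = z ^ (2 * b) := fun z b hz => by
      rw [← Real.rpow_natCast, ← Real.rpow_mul hz.le]; norm_num
    rw [e _ _ hy0, e _ _ hy0', e _ _ hy0, show 2 * ((r + 1) / 2) = r + 1 by ring,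
      show 2 * ((r + 1) / 2 - 1) = r - 1 by ring] at h
    have h1 : (y' ^ 2 - y ^ 2) ^ 2 / y ^ 2 ≤ 9 := by
      rw [div_le_iff₀ (by positivity), ← sq_abs (y' ^ 2 - y ^ 2)]
      nlinarith [abs_nonneg (y' ^ 2 - y ^ 2)]
    have h0 : 0 ≤ (y' ^ 2 - y ^ 2) ^ 2 / y ^ 2 := by positivity
    have h2 : ((r + 1) / 2 - 1) * ((y' ^ 2 - y ^ 2) ^ 2 / y ^ 2) ≤ 9 := by nlinarith
    have hp : 0 < y ^ (r - 1) := Real.rpow_pos_of_pos hy0 _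
    nlinarith
  rw [tameTest, tameTest, tameWeight]
  generalize y ^ (r + 1) = T at *
  generalize y' ^ (r + 1) = T' at *
  calc T' / (1 + d * T') - T / (1 + d * T) ≤ (T' - T) / (1 + d * T) ^ 2 := by
        rw [div_sub_div _ _ (by positivity) (by positivity), div_le_div_iff₀ (by positivity)
          (by positivity)]
        have : 0 ≤ d * (1 + d * T) * (T' - T) ^ 2 := by positivity
        nlinarith
    _ ≤ _ := by
        rw [div_mul_eq_mul_div]
        gcongr

/-- Points of `[1, ∞)` within distance `3` differ by a factor of at most `4`. So the powers are
comparable up to `16`, the damping factors up to `64`, and the quotient rule gives the order `y ^ (r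
- 1)`. The constant rounds up `61440 + 262080`. -/
theorem abs_tamePow_sub_le {d r y y' : ℝ} (hd : 0 < d) (hy : 1 ≤ y) (hy' : 1 ≤ y')
    (hyy : |y' - y| ≤ 3) (hr1 : 1 ≤ r) (hr2 : r ≤ 2) :
    |tamePow d r y' - tamePow d r y| ≤ 400000 * tameWeight d r y := by
  have hy0 : 0 < y := by linarith
  have hy0' : 0 < y' := by linarith
  have hA := abs_rpow_sub_rpow_le hy hy' hyy hr1 hr2
  obtain ⟨h1, h2⟩ := abs_le.1 hyy
  have hAA : y ^ r ≤ 16 * y' ^ r := by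
    have h3 : y ^ r ≤ (4 * y') ^ r := Real.rpow_le_rpow hy0.le (by linarith) (by linarith)
    rw [Real.mul_rpow (by norm_num) hy0'.le] at h3
    have h4 : (4 : ℝ) ^ r ≤ 4 ^ (2 : ℝ) := Real.rpow_le_rpow_of_exponent_le (by norm_num) hr2
    norm_num at h4
    nlinarith [Real.rpow_nonneg hy0'.le r]
  rw [tamePow, tamePow, tameWeight, Real.rpow_add_one hy0.ne', Real.rpow_add_one hy0'.ne']
  rw [Real.rpow_sub_one hy0.ne'] at hA ⊢
  have hA0 : 0 < y ^ r := Real.rpow_pos_of_pos hy0 r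
  have hA0' : 0 < y' ^ r := Real.rpow_pos_of_pos hy0' r
  generalize y ^ r = A at *
  generalize y' ^ r = A' at *
  have hP : 0 < 1 + d * (A * y) := by positivity
  have hP' : 0 < 1 + d * (A' * y') := by positivity
  have hPP : 1 + d * (A * y) ≤ 64 * (1 + d * (A' * y')) := by
    have h3 : A * y ≤ (16 * A') * (4 * y') := by
      apply mul_le_mul hAA (by linarith) hy0.le (by positivity)
    nlinarith
  have hdiff : |(1 + d * (A * y)) - (1 + d * (A' * y'))| ≤ 63 * ((1 + d * (A * y)) / y) := by
    have e1 : (1 + d * (A * y)) - (1 + d * (A' * y')) =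
        -d * ((A' - A) * y' + A * (y' - y)) := by ring
    have h3 : |(A' - A) * y' + A * (y' - y)| ≤ 63 * A := by
      refine (abs_add_le _ _).trans ?_
      rw [abs_mul, abs_mul, abs_of_pos hy0', abs_of_pos hA0]
      have h4 : |A' - A| * y' ≤ (15 * (A / y)) * (4 * y) :=
        mul_le_mul hA (by linarith) hy0'.le (by positivity)
      have h5 : (15 * (A / y)) * (4 * y) = 60 * A := by field_simp; norm_num
      nlinarith
    rw [e1, abs_mul, abs_neg, abs_of_pos hd]
    have h6 : d * (63 * A) ≤ 63 * ((1 + d * (A * y)) / y) := by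
      rw [add_div, show d * (A * y) / y = d * A by field_simp]
      have : 0 < 1 / y := by positivity
      linarith
    exact (mul_le_mul_of_nonneg_left h3 hd.le).trans h6
  generalize 1 + d * (A * y) = P at *
  generalize 1 + d * (A' * y') = P' at *
  have e2 : A' / P' ^ 2 - A / P ^ 2 =
      (A' - A) / P' ^ 2 + A * (P - P') * (P + P') / (P ^ 2 * P' ^ 2) := by
    field_simp; ring
  have hinv : 1 / P' ≤ 64 / P := by
    rw [div_le_div_iff₀ hP' hP]; linarith
  have hinv2 : 1 / P' ^ 2 ≤ 4096 / P ^ 2 := by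
    rw [div_le_div_iff₀ (by positivity) (by positivity)]; nlinarith
  have t1 : |(A' - A) / P' ^ 2| ≤ 61440 * (A / y / P ^ 2) := by
    rw [abs_div, abs_of_pos (by positivity : 0 < P' ^ 2), div_eq_mul_one_div]
    refine (mul_le_mul hA hinv2 (by positivity) (by positivity)).trans (le_of_eq ?_)
    field_simp; norm_num
  have t2 : |A * (P - P') * (P + P') / (P ^ 2 * P' ^ 2)| ≤ 262080 * (A / y / P ^ 2) := by
    have h7 : (P + P') / P' ^ 2 ≤ 65 * (64 / P) := by
      calc (P + P') / P' ^ 2 ≤ (65 * P') / P' ^ 2 := by gcongr; linarith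
        _ = 65 * (1 / P') := by field_simp
        _ ≤ _ := by gcongr
    have e3 : A * (P - P') * (P + P') / (P ^ 2 * P' ^ 2) =
        A / P ^ 2 * (P - P') * ((P + P') / P' ^ 2) := by field_simp
    rw [e3, abs_mul, abs_mul, abs_of_pos (by positivity : 0 < A / P ^ 2),
      abs_of_pos (by positivity : 0 < (P + P') / P' ^ 2)]
    calc A / P ^ 2 * |P - P'| * ((P + P') / P' ^ 2)
        ≤ A / P ^ 2 * (63 * (P / y)) * (65 * (64 / P)) := by gcongr
      _ = 262080 * (A / y / P ^ 2) := by field_simp; norm_num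
  rw [e2]
  have h8 : 0 ≤ A / y / P ^ 2 := by positivity
  refine (abs_add_le _ _).trans ?_
  linarith

/-- A form of Young's inequality, by cases: either `v ≤ t * y` and the first term suffices, or `y <
v / t` and the second does. It lets a small multiple of the main term absorb the remainder of order
`y ^ (r - 1)`, uniformly in `d`. -/
theorem tameWeight_mul_le {d r y v t : ℝ} (hd : 0 < d) (hy : 1 ≤ y) (hv : 0 ≤ v) (ht : 0 < t)
    (hr1 : 1 ≤ r) :
    tameWeight d r y * v ≤ t * tamePow d r y + t ^ (1 - r) * v ^ r := by
  have hy0 : 0 < y := by linarith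
  have hw := tameWeight_nonneg (d := d) (r := r) hy
  rcases le_or_gt v (t * y) with h | h
  · have h1 : 0 ≤ t ^ (1 - r) * v ^ r :=
      mul_nonneg (Real.rpow_nonneg ht.le _) (Real.rpow_nonneg hv _)
    rw [tamePow_eq hy]
    nlinarith
  · have hv0 : 0 < v := lt_trans (by positivity) h
    have h2 : tameWeight d r y ≤ y ^ (r - 1) := by
      refine div_le_self (Real.rpow_nonneg hy0.le _) (one_le_pow₀ ?_)
      have : 0 ≤ d * y ^ (r + 1) := by positivity
      linarith
    have h3 : y ^ (r - 1) ≤ (v / t) ^ (r - 1) :=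
      Real.rpow_le_rpow hy0.le (by rw [le_div_iff₀ ht]; linarith) (by linarith)
    have h4 : (v / t) ^ (r - 1) * v = t ^ (1 - r) * v ^ r := by
      rw [Real.div_rpow hv ht.le, Real.rpow_sub_one hv0.ne', show 1 - r = -(r - 1) by ring,
        Real.rpow_neg ht.le]
      field_simp
    have h5 : tameWeight d r y * v ≤ (v / t) ^ (r - 1) * v :=
      mul_le_mul_of_nonneg_right (h2.trans h3) hv
    have h6 := mul_nonneg ht.le (tamePow_nonneg (d := d) (r := r) hy)
    linarith

theorem le_add_rpow_mul {v K r : ℝ} (hv : 0 ≤ v) (hK : 0 < K) (hr : 1 ≤ r) :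
    v ≤ K + K ^ (1 - r) * v ^ r := by
  rcases le_or_gt v K with h | h
  · have := mul_nonneg (Real.rpow_nonneg hK.le (1 - r)) (Real.rpow_nonneg hv r)
    linarith
  · have hv0 : 0 < v := hK.trans h
    have h1 : 1 ≤ (v / K) ^ (r - 1) :=
      Real.one_le_rpow ((one_le_div hK).2 h.le) (by linarith)
    have h2 : K ^ (1 - r) * v ^ r = (v / K) ^ (r - 1) * v := by
      rw [Real.div_rpow hv hK.le, Real.rpow_sub_one hv0.ne', show 1 - r = -(r - 1) by ring,
        Real.rpow_neg hK.le]
      field_simp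
    rw [h2]
    nlinarith

/-! ### The imbalance of the queue lengths -/

/-- The deviation of queue `j` from the average queue length. -/
noncomputable def queueDev {n : ℕ} (q : Fin n → ℕ) (j : Fin n) : ℝ :=
  (q j : ℝ) - (∑ l, (q l : ℝ)) / n

/-- The Euclidean size of the deviations from the average queue length, bounded away from `0`. -/
noncomputable def imbalance {n : ℕ} (q : Fin n → ℕ) : ℝ := √(1 + ∑ j, queueDev q j ^ 2)

theorem sum_queueDev {n : ℕ} [NeZero n] (q : Fin n → ℕ) : ∑ j, queueDev q j = 0 := by
  have hn : (n : ℝ) ≠ 0 := NeZero.ne _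
  simp only [queueDev, Finset.sum_sub_distrib, Finset.sum_const, Finset.card_univ,
    Fintype.card_fin, nsmul_eq_mul]
  field_simp
  ring

theorem imbalance_sq {n : ℕ} (q : Fin n → ℕ) : imbalance q ^ 2 = 1 + ∑ j, queueDev q j ^ 2 :=
  Real.sq_sqrt (by positivity)

theorem one_le_imbalance {n : ℕ} (q : Fin n → ℕ) : 1 ≤ imbalance q :=
  Real.one_le_sqrt.2 (le_add_of_nonneg_right (by positivity))

theorem abs_queueDev_le {n : ℕ} (q : Fin n → ℕ) (j : Fin n) : |queueDev q j| ≤ imbalance q := by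
  refine Real.abs_le_sqrt ?_
  have := Finset.single_le_sum (fun l _ => sq_nonneg (queueDev q l)) (Finset.mem_univ j)
  linarith

/-- The deviations are the projection of `q` orthogonal to the diagonal, and the projection of a
unit vector has squared length `1 - 1 / n`. -/
theorem imbalance_sq_of_shift {n : ℕ} [NeZero n] {q q' : Fin n → ℕ} {j : Fin n} {t : ℝ}
    (h : ∀ l, (q' l : ℝ) = q l + t * Pi.single (M := fun _ => ℝ) j 1 l) :
    imbalance q' ^ 2 = imbalance q ^ 2 + 2 * t * queueDev q j + t ^ 2 * (1 - 1 / n) := by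
  have hn : (n : ℝ) ≠ 0 := NeZero.ne _
  have h1 : ∀ l, queueDev q' l =
      queueDev q l + t * (Pi.single (M := fun _ => ℝ) j 1 l - 1 / n) := by
    intro l
    simp only [queueDev, h, Finset.sum_add_distrib, ← Finset.mul_sum]
    rw [Finset.sum_pi_single' j (1 : ℝ)]
    simp only [Finset.mem_univ, if_true]
    field_simp
    ring
  have h2 : ∑ l, queueDev q l * Pi.single (M := fun _ => ℝ) j 1 l = queueDev q j := by
    simp [Pi.single_apply]
  have h3 : ∑ l, Pi.single (M := fun _ => ℝ) j 1 l = 1 := by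
    simp [Pi.single_apply]
  have h4 : ∑ l, Pi.single (M := fun _ => ℝ) j 1 l ^ 2 = 1 := by
    simp [Pi.single_apply]
  have h5 : ∀ l, queueDev q' l ^ 2 = queueDev q l ^ 2 +
      (2 * t * (queueDev q l * Pi.single (M := fun _ => ℝ) j 1 l) - 2 * t / n * queueDev q l) +
      t ^ 2 * (Pi.single (M := fun _ => ℝ) j 1 l ^ 2 -
        2 / n * Pi.single (M := fun _ => ℝ) j 1 l + 1 / n ^ 2) := by
    intro l
    rw [h1]
    field_simp
    ring
  simp only [imbalance_sq, h5, Finset.sum_add_distrib, Finset.sum_sub_distrib, ← Finset.mul_sum,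
    h2, h3, h4, sum_queueDev, Finset.sum_const, Finset.card_univ, Fintype.card_fin, nsmul_eq_mul]
  field_simp
  ring

theorem imbalance_add_single {n : ℕ} [NeZero n] (q : Fin n → ℕ) (j : Fin n) :
    imbalance (q + Pi.single j 1) ^ 2 = imbalance q ^ 2 + 2 * queueDev q j + (1 - 1 / n) := by
  rw [imbalance_sq_of_shift (t := 1) (j := j) (q := q)]
  · ring
  · intro l
    by_cases hl : l = j
    · subst hl; simp
    · simp [hl]

theorem imbalance_sub_single {n : ℕ} [NeZero n] (q : Fin n → ℕ) {j : Fin n} (hj : q j ≠ 0) :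
    imbalance (q - Pi.single j 1) ^ 2 = imbalance q ^ 2 - 2 * queueDev q j + (1 - 1 / n) := by
  rw [imbalance_sq_of_shift (t := -1) (j := j) (q := q)]
  · ring
  · intro l
    by_cases hl : l = j
    · subst hl
      have : 1 ≤ q l := Nat.one_le_iff_ne_zero.2 hj
      simp [Nat.cast_sub this]
      ring
    · simp [hl]

theorem one_sub_inv_mem {n : ℕ} [NeZero n] : (0 : ℝ) ≤ 1 - 1 / n ∧ (1 : ℝ) - 1 / n ≤ 1 := by
  have h : (1 : ℝ) ≤ n := by exact_mod_cast NeZero.one_le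
  constructor
  · have := div_le_one_of_le₀ h (by linarith)
    linarith
  · have : (0 : ℝ) ≤ 1 / n := by positivity
    linarith

theorem abs_sub_le_of_abs_sq_sub_le {y y' : ℝ} (hy : 1 ≤ y) (hy' : 1 ≤ y')
    (h : |y' ^ 2 - y ^ 2| ≤ 3 * y) : |y' - y| ≤ 3 := by
  rw [sq_sub_sq, abs_mul, abs_of_pos (by linarith)] at h
  have h2 : y * |y' - y| ≤ (y' + y) * |y' - y| :=
    mul_le_mul_of_nonneg_right (by linarith) (abs_nonneg _)
  by_contra! h3
  nlinarith

theorem abs_imbalance_sq_add_single {n : ℕ} [NeZero n] (q : Fin n → ℕ) (j : Fin n) :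
    |imbalance (q + Pi.single j 1) ^ 2 - imbalance q ^ 2| ≤ 3 * imbalance q := by
  rw [imbalance_add_single]
  obtain ⟨h1, h2⟩ := one_sub_inv_mem (n := n)
  obtain ⟨h3, h4⟩ := abs_le.1 (abs_queueDev_le q j)
  have := one_le_imbalance q
  rw [abs_le]
  constructor <;> linarith

theorem abs_imbalance_sq_sub_single {n : ℕ} [NeZero n] (q : Fin n → ℕ) {j : Fin n}
    (hj : q j ≠ 0) :
    |imbalance (q - Pi.single j 1) ^ 2 - imbalance q ^ 2| ≤ 3 * imbalance q := by
  rw [imbalance_sub_single q hj]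
  obtain ⟨h1, h2⟩ := one_sub_inv_mem (n := n)
  obtain ⟨h3, h4⟩ := abs_le.1 (abs_queueDev_le q j)
  have := one_le_imbalance q
  rw [abs_le]
  constructor <;> linarith

/-- A shortest queue lies below the average by at least the imbalance, up to a factor. -/
theorem imbalance_le {n : ℕ} [NeZero n] {q : Fin n → ℕ} {m : ℝ}
    (hm : ∀ j, m ≤ queueDev q j) : imbalance q ≤ 1 + n ^ 2 * (-m) := by
  have hn : (1 : ℝ) ≤ n := by exact_mod_cast NeZero.one_le
  have hm0 : m ≤ 0 := by
    by_contra! h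
    have := Finset.sum_pos (s := Finset.univ) (fun j _ => h.trans_le (hm j)) Finset.univ_nonempty
    rw [sum_queueDev] at this
    exact lt_irrefl _ this
  -- These differences are nonnegative and sum to `-n * m`, because the deviations sum to zero. Each
  -- one is therefore at most the total.
  have h1 : ∀ j, queueDev q j - m ≤ n * (-m) := by
    intro j
    have h2 := Finset.single_le_sum (f := fun l => queueDev q l - m)
      (fun l _ => sub_nonneg.2 (hm l)) (Finset.mem_univ j)
    simp only [Finset.sum_sub_distrib, sum_queueDev, Finset.sum_const, Finset.card_univ,
      Fintype.card_fin, nsmul_eq_mul] at h2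
    linarith
  have h2 : ∀ j, queueDev q j ^ 2 ≤ (n * (-m)) ^ 2 := by
    intro j
    rw [sq_le_sq, abs_of_nonneg (by nlinarith : 0 ≤ (n : ℝ) * -m), abs_le]
    have := hm j
    have := h1 j
    constructor <;> nlinarith
  refine Real.sqrt_le_iff.2 ⟨by nlinarith [sq_nonneg (n : ℝ)], ?_⟩
  have h3 := Finset.sum_le_sum (s := Finset.univ) fun j _ => h2 j
  simp only [Finset.sum_const, Finset.card_univ, Fintype.card_fin, nsmul_eq_mul] at h3
  have h4 : (n : ℝ) * (n * (-m)) ^ 2 ≤ (n ^ 2 * (-m)) ^ 2 := by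
    have : (n : ℝ) ^ 3 ≤ n ^ 4 := pow_le_pow_right₀ hn (by norm_num)
    nlinarith [sq_nonneg m]
  have h5 : 0 ≤ (n : ℝ) ^ 2 * (-m) := mul_nonneg (sq_nonneg _) (by linarith)
  nlinarith

/-! ### Drift of functions of the imbalance -/

section Drift

variable {Z : Type*} {n : ℕ} {α : Z → Z → ℝ} {stat : PMF Z} {lam : Z → ℝ}
  {μ : Z → Fin n → ℝ} {M : ℝ} {p : PMF (Z × (Fin n → ℕ))}

theorem queueDrift_mono [NeZero n] (hlam : ∀ i, 0 ≤ lam i) (hμ : ∀ i j, 0 ≤ μ i j)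
    {F : (Fin n → ℕ) → ℝ} {x : Z × (Fin n → ℕ)} {a b : Fin n → ℝ}
    (ha : ∀ j, F (x.2 + Pi.single j 1) - F x.2 ≤ a j)
    (hb : ∀ j, x.2 j ≠ 0 → F (x.2 - Pi.single j 1) - F x.2 ≤ b j) :
    queueDrift lam μ F x ≤ lam x.1 * ∑ j, jsqRoute x.2 j * a j +
      ∑ j, (if x.2 j = 0 then 0 else μ x.1 j) * b j := by
  refine add_le_add (mul_le_mul_of_nonneg_left (Finset.sum_le_sum fun j _ =>
    mul_le_mul_of_nonneg_left (ha j) (jsqRoute_nonneg _ _)) (hlam _))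
    (Finset.sum_le_sum fun j _ => ?_)
  split_ifs with h
  · simp
  · exact mul_le_mul_of_nonneg_left (hb j h) (hμ _ _)

theorem IsSteadyJSQ.queueDrift_le_of_le [NeZero n] (H : IsSteadyJSQ α stat lam μ M p)
    {F : (Fin n → ℕ) → ℝ} {x : Z × (Fin n → ℕ)} {c : ℝ} (hc : 0 ≤ c)
    (ha : ∀ j, F (x.2 + Pi.single j 1) - F x.2 ≤ c)
    (hb : ∀ j, x.2 j ≠ 0 → F (x.2 - Pi.single j 1) - F x.2 ≤ c) :
    queueDrift lam μ F x ≤ (M + n * M) * c := by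
  refine (queueDrift_mono H.lam_nonneg H.mu_nonneg ha hb).trans ?_
  rw [← Finset.sum_mul, sum_jsqRoute, one_mul, ← Finset.sum_mul, ← add_mul]
  refine mul_le_mul_of_nonneg_right (add_le_add (H.lam_le _) ?_) hc
  refine le_trans (Finset.sum_le_sum fun j _ => ?_) (totalService_le H.mu_le x.1)
  split_ifs
  · exact H.mu_nonneg _ _
  · exact le_rfl

theorem queueDrift_neg {F : (Fin n → ℕ) → ℝ} {x : Z × (Fin n → ℕ)} :
    queueDrift lam μ (fun q => -F q) x = -queueDrift lam μ F x := by
  simp only [queueDrift, ← neg_sub', mul_neg, Finset.sum_neg_distrib]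
  ring

theorem IsSteadyJSQ.abs_queueDrift_le [NeZero n] (H : IsSteadyJSQ α stat lam μ M p)
    {F : (Fin n → ℕ) → ℝ} {x : Z × (Fin n → ℕ)} {c : ℝ} (hc : 0 ≤ c)
    (ha : ∀ j, |F (x.2 + Pi.single j 1) - F x.2| ≤ c)
    (hb : ∀ j, x.2 j ≠ 0 → |F (x.2 - Pi.single j 1) - F x.2| ≤ c) :
    |queueDrift lam μ F x| ≤ (M + n * M) * c := by
  rw [abs_le', ← queueDrift_neg]
  refine ⟨H.queueDrift_le_of_le hc (fun j => (abs_le.1 (ha j)).2)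
    fun j hj => (abs_le.1 (hb j hj)).2, H.queueDrift_le_of_le hc (fun j => ?_) fun j hj => ?_⟩
  · linarith [(abs_le.1 (ha j)).1]
  · linarith [(abs_le.1 (hb j hj)).1]

theorem IsSteadyJSQ.abs_queueDrift_tamePow_le [NeZero n] (H : IsSteadyJSQ α stat lam μ M p)
    {d r : ℝ} (hd : 0 < d) (hr1 : 1 ≤ r) (hr2 : r ≤ 2) (x : Z × (Fin n → ℕ)) :
    |queueDrift lam μ (fun q => tamePow d r (imbalance q)) x| ≤
      (M + n * M) * (400000 * tameWeight d r (imbalance x.2)) := by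
  refine H.abs_queueDrift_le
    (mul_nonneg (by norm_num) (tameWeight_nonneg (one_le_imbalance _))) (fun j => ?_)
    fun j hj => ?_
  · exact abs_tamePow_sub_le hd (one_le_imbalance _) (one_le_imbalance _)
      (abs_sub_le_of_abs_sq_sub_le (one_le_imbalance _) (one_le_imbalance _)
        (abs_imbalance_sq_add_single _ _)) hr1 hr2
  · exact abs_tamePow_sub_le hd (one_le_imbalance _) (one_le_imbalance _)
      (abs_sub_le_of_abs_sq_sub_le (one_le_imbalance _) (one_le_imbalance _)
        (abs_imbalance_sq_sub_single _ hj)) hr1 hr2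

/-- The drift of the deviations: arrivals at a shortest queue outweigh the departures. -/
theorem IsSteadyJSQ.drift_queueDev_le [NeZero n] (H : IsSteadyJSQ α stat lam μ M p)
    (hssc : SSCLoadCondition lam μ) (x : Z × (Fin n → ℕ)) :
    lam x.1 * ∑ j, jsqRoute x.2 j * queueDev x.2 j +
        ∑ j, (if x.2 j = 0 then 0 else μ x.1 j) * -queueDev x.2 j ≤
      -((lam x.1 - (totalService μ x.1 - n * ⨅ j, μ x.1 j)) *
        ((imbalance x.2 - 1) / n ^ 2)) := by
  have hn : (0 : ℝ) < n := by exact_mod_cast NeZero.pos n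
  obtain ⟨l, hl⟩ := shortestQueues_nonempty x.2
  have hmin : ∀ k ∈ shortestQueues x.2, ∀ j, x.2 k ≤ x.2 j := fun k hk => by
    simpa [shortestQueues] using hk
  set m := queueDev x.2 l with hm
  have hmj : ∀ j, m ≤ queueDev x.2 j := fun j => by
    have : (x.2 l : ℝ) ≤ x.2 j := by exact_mod_cast hmin l hl j
    simp only [hm, queueDev]; linarith
  have h1 : ∑ j, jsqRoute x.2 j * queueDev x.2 j = m := by
    have : ∀ j, jsqRoute x.2 j * queueDev x.2 j = jsqRoute x.2 j * m := by
      intro j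
      by_cases hj : j ∈ shortestQueues x.2
      · have e : x.2 j = x.2 l := le_antisymm (hmin j hj l) (hmin l hl j)
        simp only [hm, queueDev, e]
      · simp [jsqRoute, hj]
    simp only [this, ← Finset.sum_mul, sum_jsqRoute, one_mul]
  have hb : BddBelow (Set.range fun j => μ x.1 j) :=
    ⟨0, by rintro _ ⟨j, rfl⟩; exact H.mu_nonneg _ _⟩
  set s := ⨅ j, μ x.1 j with hs
  have h2 : ∑ j, (if x.2 j = 0 then 0 else μ x.1 j) * -queueDev x.2 j ≤
      -((totalService μ x.1 - n * s) * m) := by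
    -- Split `μ x.1 j` into the minimal rate `s` and an excess. The part `s` is common to all
    -- servers and cancels on summation, and in the excess each deviation is at least `m`. An empty
    -- queue is not above average, so its missing departures do no harm.
    have h3 : ∀ j, (if x.2 j = 0 then 0 else μ x.1 j) * -queueDev x.2 j ≤
        -((μ x.1 j - s) * m) - s * queueDev x.2 j := by
      intro j
      have h4 : s ≤ μ x.1 j := ciInf_le hb j
      have h5 : (μ x.1 j - s) * m ≤ (μ x.1 j - s) * queueDev x.2 j :=
        mul_le_mul_of_nonneg_left (hmj j) (by linarith)
      split_ifs with h
      · have h6 : queueDev x.2 j ≤ 0 := by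
          rw [queueDev, h, Nat.cast_zero, zero_sub]
          exact neg_nonpos.2 (by positivity)
        have := mul_nonneg (H.mu_nonneg x.1 j) (neg_nonneg.2 h6)
        linarith
      · linarith
    refine (Finset.sum_le_sum fun j _ => h3 j).trans (le_of_eq ?_)
    rw [Finset.sum_sub_distrib, ← Finset.mul_sum, sum_queueDev, Finset.sum_neg_distrib,
      ← Finset.sum_mul, Finset.sum_sub_distrib]
    simp [totalService]
  have hgap := hssc x.1
  have h3 : (imbalance x.2 - 1) / n ^ 2 ≤ -m := by
    rw [div_le_iff₀ (by positivity)]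
    linarith [imbalance_le hmj]
  have h4 := mul_le_mul_of_nonneg_left h3
    (by linarith : 0 ≤ lam x.1 - (totalService μ x.1 - n * s))
  rw [h1]
  linarith

/-- The linear part of the increments gives the drift of the deviations. The constant `11` in the
proof is `9` from `tameTest_sub_le` plus a bound `2` for the jump term `1 - 1 / n`; replacing `y -
1` by `y` costs another `3`, and `20` exceeds the sum. -/
theorem IsSteadyJSQ.queueDrift_tameTest_le [NeZero n] (H : IsSteadyJSQ α stat lam μ M p)
    (hssc : SSCLoadCondition lam μ) {d r : ℝ} (hd : 0 < d) (hr1 : 1 ≤ r) (hr2 : r ≤ 2)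
    {δ : Z → ℝ} (hδ : ∀ i, δ i ≤ lam i - (totalService μ i - n * ⨅ j, μ i j))
    (x : Z × (Fin n → ℕ)) :
    queueDrift lam μ (fun q => tameTest d r (imbalance q)) x ≤
      -((r + 1) / n ^ 2) * (δ x.1 * tamePow d r (imbalance x.2)) +
        20 * (M + n * M) * tameWeight d r (imbalance x.2) := by
  have hn : (1 : ℝ) ≤ n := by exact_mod_cast NeZero.one_le
  set y := imbalance x.2 with hy
  set w := tameWeight d r y with hw
  have hy1 : 1 ≤ y := one_le_imbalance _
  have hw0 : 0 ≤ w := tameWeight_nonneg hy1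
  obtain ⟨hn1, hn2⟩ := one_sub_inv_mem (n := n)
  have hA := queueDrift_mono (x := x) (F := fun q => tameTest d r (imbalance q))
    (a := fun j => w * (r + 1) * queueDev x.2 j + 11 * w)
    (b := fun j => w * (r + 1) * -queueDev x.2 j + 11 * w) H.lam_nonneg H.mu_nonneg
    (fun j => by
      refine (tameTest_sub_le hd hy1 (one_le_imbalance _)
        (abs_imbalance_sq_add_single x.2 j) hr1 hr2).trans ?_
      rw [imbalance_add_single, ← hw, ← hy]
      have : (r + 1) / 2 * (1 - 1 / n) ≤ 2 * 1 :=
        mul_le_mul (by linarith) hn2 hn1 (by norm_num)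
      nlinarith)
    (fun j hj => by
      refine (tameTest_sub_le hd hy1 (one_le_imbalance _)
        (abs_imbalance_sq_sub_single x.2 hj) hr1 hr2).trans ?_
      rw [imbalance_sub_single _ hj, ← hw, ← hy]
      have : (r + 1) / 2 * (1 - 1 / n) ≤ 2 * 1 :=
        mul_le_mul (by linarith) hn2 hn1 (by norm_num)
      nlinarith)
  have hB := H.drift_queueDev_le hssc x
  rw [← hy] at hB
  have hgap := hssc x.1
  have hgδ := hδ x.1
  have hS : (∑ j, if x.2 j = 0 then 0 else μ x.1 j) ≤ n * M :=
    le_trans (Finset.sum_le_sum fun j _ => by split_ifs; exacts [H.mu_nonneg _ _, le_rfl])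
      (totalService_le H.mu_le x.1)
  have hinf : (⨅ j, μ x.1 j) ≤ M :=
    (ciInf_le ⟨0, by rintro _ ⟨j, rfl⟩; exact H.mu_nonneg _ _⟩ (0 : Fin n)).trans (H.mu_le _ _)
  have hgM : lam x.1 - (totalService μ x.1 - n * ⨅ j, μ x.1 j) ≤ M + n * M := by
    have := H.lam_le x.1
    have := totalService_nonneg H.mu_nonneg x.1
    nlinarith
  set g := lam x.1 - (totalService μ x.1 - n * ⨅ j, μ x.1 j) with hg
  have hg0 : 0 ≤ g := by linarith
  have hL := H.lam_le x.1
  have e1 : lam x.1 * ∑ j, jsqRoute x.2 j * (w * (r + 1) * queueDev x.2 j + 11 * w) +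
      ∑ j, (if x.2 j = 0 then 0 else μ x.1 j) * (w * (r + 1) * -queueDev x.2 j + 11 * w) =
      w * (r + 1) * (lam x.1 * ∑ j, jsqRoute x.2 j * queueDev x.2 j +
        ∑ j, (if x.2 j = 0 then 0 else μ x.1 j) * -queueDev x.2 j) +
      11 * w * (lam x.1 + ∑ j, if x.2 j = 0 then 0 else μ x.1 j) := by
    have e2 : ∀ a b : Fin n → ℝ, ∑ j, a j * (w * (r + 1) * b j + 11 * w) =
        w * (r + 1) * ∑ j, a j * b j + 11 * w * ∑ j, a j := fun a b => by
      rw [Finset.mul_sum, Finset.mul_sum, ← Finset.sum_add_distrib]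
      exact Finset.sum_congr rfl fun j _ => by ring
    rw [e2 _ (queueDev x.2), e2 _ (fun j => -queueDev x.2 j), sum_jsqRoute]
    ring
  rw [e1] at hA
  have h1 := mul_le_mul_of_nonneg_left hB (by positivity : 0 ≤ w * (r + 1))
  have h2 : 11 * w * (lam x.1 + ∑ j, if x.2 j = 0 then 0 else μ x.1 j) ≤
      11 * w * (M + n * M) := mul_le_mul_of_nonneg_left (by linarith) (by positivity)
  have h3 : w * (r + 1) * -(g * ((y - 1) / n ^ 2)) ≤
      -((r + 1) / n ^ 2) * (δ x.1 * (y * w)) + 3 * w * (M + n * M) := by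
    have e2 : w * (r + 1) * -(g * ((y - 1) / n ^ 2)) =
        -((r + 1) / n ^ 2) * (g * (y * w)) + ((r + 1) / n ^ 2) * w * g := by
      field_simp; ring
    have h4 : δ x.1 * (y * w) ≤ g * (y * w) := mul_le_mul_of_nonneg_right hgδ (by positivity)
    have h5 : (r + 1) / n ^ 2 ≤ 3 := by
      rw [div_le_iff₀ (by positivity)]
      have : (1 : ℝ) ≤ n ^ 2 := one_le_pow₀ hn
      linarith
    have h6 : 0 ≤ (r + 1) / n ^ 2 := by positivity
    have h7 : (r + 1) / n ^ 2 * w * g ≤ 3 * w * (M + n * M) :=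
      mul_le_mul (mul_le_mul_of_nonneg_right h5 hw0) hgM hg0 (by positivity)
    rw [e2]
    nlinarith [mul_le_mul_of_nonneg_left h4 h6]
  rw [tamePow_eq hy1, ← hw]
  have h8 : 0 ≤ w * (M + n * M) := mul_nonneg hw0 (hg0.trans hgM)
  linarith

end Drift

/-! ### State space collapse -/

theorem HasFiniteMean.of_rpow {X : Type*} {p : PMF X} {f : X → ℝ} {r : ℝ} (hr : 1 ≤ r)
    (hf : HasFiniteMean p fun x => |f x| ^ r) : HasFiniteMean p f :=
  ((hasFiniteMean_const 1).add hf).of_le fun x => by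
    simpa using le_add_rpow_mul (abs_nonneg (f x)) one_pos hr

theorem tendsto_tamePow {r y : ℝ} :
    Tendsto (fun d => tamePow d r y) (𝓝[>] 0) (𝓝 (y ^ r)) := by
  have h : ContinuousAt (fun d => tamePow d r y) 0 := by
    unfold tamePow
    refine ContinuousAt.div continuousAt_const (by fun_prop) (by simp)
  have h2 := h.tendsto
  simp only [tamePow, zero_mul, add_zero, one_pow, div_one] at h2
  exact h2.mono_left nhdsWithin_le_nhds

section Collapse

variable {Z : Type*} {n : ℕ} {α : Z → Z → ℝ} {stat : PMF Z} {lam : Z → ℝ}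
  {μ : Z → Fin n → ℝ} {M : ℝ} {p : PMF (Z × (Fin n → ℕ))}

theorem IsSteadyJSQ.expect_tamePow_le [NeZero n] (H : IsSteadyJSQ α stat lam μ M p)
    (hssc : SSCLoadCondition lam μ) {δ W : Z → ℝ} (hW : IsPoissonSolution α stat δ W)
    (hδ : ∀ i, δ i ≤ lam i - (totalService μ i - n * ⨅ j, μ i j))
    {d r t K D A : ℝ} (hd : 0 < d) (hr1 : 1 ≤ r) (hr2 : r ≤ 2) (hM : 0 ≤ M)
    (hK : (1200020 : ℝ) * (M + n * M) = K) (hD : 0 < D) (hDδ : D ≤ expect stat δ)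
    (ht : (r + 1) / n ^ 2 * D / (4 * (K + 1)) = t)
    (hWr : HasFiniteMean stat fun i => |W i| ^ r) (hA : expect stat (fun i => |W i| ^ r) ≤ A) :
    expect p (fun x => tamePow d r (imbalance x.2)) ≤
      K * t ^ (1 - r) * (1 + A) / ((r + 1) / n ^ 2 * D / 2) := by
  have hn : (1 : ℝ) ≤ n := by exact_mod_cast NeZero.one_le
  have hM' : 0 ≤ M + n * M := by positivity
  have hK0 : 0 ≤ K := by rw [← hK]; positivity
  set κ : ℝ := (r + 1) / n ^ 2 with hκ
  have hκ0 : 0 < κ := by positivity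
  have hκ3 : κ ≤ 3 := by
    rw [hκ, div_le_iff₀ (by positivity)]
    have : (1 : ℝ) ≤ n ^ 2 := one_le_pow₀ hn
    linarith
  have ht0 : 0 < t := by rw [← ht]; positivity
  have hF1 : ∀ x : Z × (Fin n → ℕ), |tamePow d r (imbalance x.2)| ≤ 1 / d := fun x => by
    rw [abs_of_nonneg (tamePow_nonneg (one_le_imbalance _))]
    exact tamePow_le hd (one_le_imbalance _)
  have hWm : HasFiniteMean stat W := hWr.of_rpow hr1
  have h1 := H.drift_eq (F := fun q => tameTest d r (imbalance q)) (V := fun _ => 1)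
    (g := fun _ => 0) (fun i => by simpa using H.rate.hasSum_row i)
    (hasFiniteMean_of_bounded (C := 1 / d) fun x => by
      rw [mul_one]; exact abs_tameTest_le hd (one_le_imbalance _))
  have h2 := H.drift_eq (F := fun q => tamePow d r (imbalance q))
    (fun i => hW.hasSum H.rate i) (HasFiniteMean.bounded_mul hF1 (H.hasFiniteMean_fst hWm))
  -- The test function is the damped `y ^ (r + 1)` minus `κ * W` times the damped `y ^ r`. By the
  -- Poisson equation, the `-κ * δ` in front of the damped `y ^ r` becomes `-κ * expect stat δ`, and
  -- what remains has order `y ^ (r - 1) * (1 + |W|)`.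
  have h3 := h1.sub (h2.mul_left κ)
  have hub : HasFiniteMean p fun x => -(κ * D / 2) * tamePow d r (imbalance x.2) +
      K * t ^ (1 - r) * (1 + |W x.1| ^ r) :=
    ((hasFiniteMean_of_bounded hF1).const_mul _).add
      (((hasFiniteMean_const 1).add (H.hasFiniteMean_fst hWr)).const_mul _)
  have h4 := hasSum_le (fun x => ?_) h3 hub.hasSum
  · rw [mul_zero, sub_zero, expect_add ((hasFiniteMean_of_bounded hF1).const_mul _)
      (((hasFiniteMean_const 1).add (H.hasFiniteMean_fst hWr)).const_mul _), expect_const_mul,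
      expect_const_mul, expect_add (hasFiniteMean_const 1) (H.hasFiniteMean_fst hWr),
      expect_const, H.expect_fst hWr] at h4
    rw [le_div_iff₀ (by positivity)]
    have h5 : 0 ≤ K * t ^ (1 - r) := mul_nonneg hK0 (Real.rpow_nonneg ht0.le _)
    nlinarith [mul_le_mul_of_nonneg_left hA h5]
  · have hφ := H.queueDrift_tameTest_le hssc hd hr1 hr2 hδ x
    have hF := H.abs_queueDrift_tamePow_le hd hr1 hr2 x
    have hy := one_le_imbalance x.2
    have hb1 := tameWeight_mul_le hd hy zero_le_one ht0 hr1
    have hb2 := tameWeight_mul_le hd hy (abs_nonneg (W x.1)) ht0 hr1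
    rw [Real.one_rpow, mul_one, mul_one] at hb1
    have hFn := tamePow_nonneg (d := d) (r := r) hy
    have hwn := tameWeight_nonneg (d := d) (r := r) hy
    rw [← hκ] at hφ
    set F := tamePow d r (imbalance x.2)
    set w := tameWeight d r (imbalance x.2)
    set φ' := queueDrift lam μ (fun q => tameTest d r (imbalance q)) x
    set F' := queueDrift lam μ (fun q => tamePow d r (imbalance q)) x
    have h5 : -(W x.1 * F') ≤ |W x.1| * ((M + n * M) * (400000 * w)) := by
      refine (neg_le_abs _).trans ?_
      rw [abs_mul]
      exact mul_le_mul_of_nonneg_left hF (abs_nonneg _)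
    have h6 : κ * -(W x.1 * F') ≤ 3 * (|W x.1| * ((M + n * M) * (400000 * w))) :=
      (mul_le_mul_of_nonneg_left h5 hκ0.le).trans
        (mul_le_mul_of_nonneg_right hκ3 (by positivity))
    have h7 : κ * (D * F) ≤ κ * (expect stat δ * F) :=
      mul_le_mul_of_nonneg_left (mul_le_mul_of_nonneg_right hDδ hFn) hκ0.le
    have h8 : 20 * (M + n * M) * w + 3 * (|W x.1| * ((M + n * M) * (400000 * w))) ≤
        K * (w + w * |W x.1|) := by
      rw [← hK]
      have := mul_nonneg hM' hwn
      have := mul_nonneg this (abs_nonneg (W x.1))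
      nlinarith
    have h9 : K * (w + w * |W x.1|) ≤
        K * (2 * (t * F) + t ^ (1 - r) * (1 + |W x.1| ^ r)) :=
      mul_le_mul_of_nonneg_left (by linarith) hK0
    -- The value of `t` makes the absorbed terms at most half of the negative drift. The `K + 1` in
    -- its denominator keeps it meaningful when `K = 0`.
    have h10 : K * (2 * (t * F)) ≤ κ * D / 2 * F := by
      have : K * (2 * t) ≤ κ * D / 2 := by
        rw [← ht, mul_div_assoc', mul_div_assoc', div_le_div_iff₀ (by positivity) two_pos]
        nlinarith [mul_pos hκ0 hD]
      nlinarith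
    rw [← mul_assoc κ, mul_comm κ, mul_assoc, ← mul_sub]
    refine mul_le_mul_of_nonneg_left ?_ ENNReal.toReal_nonneg
    nlinarith

/-- Uniform bound on the moment of order `r` of the imbalance, given a lower bound `δ` on the
surplus in the load condition that has positive mean and a solution `W` to its Poisson equation
with a finite moment of order `r`. -/
theorem exists_imbalance_moment_bound [NeZero n] (α : Z → Z → ℝ) (stat : PMF Z)
    (μ : Z → Fin n → ℝ) {M : ℝ} (hM : 0 ≤ M) {r D : ℝ} (hr1 : 1 ≤ r) (hr2 : r ≤ 2) (hD : 0 < D)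
    (A : ℝ) :
    ∃ C, ∀ (lam : Z → ℝ) (p : PMF (Z × (Fin n → ℕ))), IsSteadyJSQ α stat lam μ M p →
      SSCLoadCondition lam μ → ∀ δ W : Z → ℝ, IsPoissonSolution α stat δ W →
      (∀ i, δ i ≤ lam i - (totalService μ i - n * ⨅ j, μ i j)) → D ≤ expect stat δ →
      HasFiniteMean stat (fun i => |W i| ^ r) → expect stat (fun i => |W i| ^ r) ≤ A →
      HasFiniteMean p (fun x => imbalance x.2 ^ r) ∧
        expect p (fun x => imbalance x.2 ^ r) ≤ C := by
  obtain ⟨K, hK⟩ : ∃ K, (1200020 : ℝ) * (M + n * M) = K := ⟨_, rfl⟩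
  obtain ⟨t, ht⟩ : ∃ t, (r + 1) / n ^ 2 * D / (4 * (K + 1)) = t := ⟨_, rfl⟩
  refine ⟨K * t ^ (1 - r) * (1 + A) / ((r + 1) / n ^ 2 * D / 2),
    fun lam p H hssc δ W hW hδ hDδ hWr hA => ?_⟩
  -- The bound on the damped moment does not depend on `d`. Letting `d ↓ 0` in finite partial sums,
  -- as in Fatou's lemma, gives integrability of the undamped power as well.
  have hfin : ∀ s : Finset (Z × (Fin n → ℕ)), ∑ x ∈ s, (p x).toReal * imbalance x.2 ^ r ≤
      K * t ^ (1 - r) * (1 + A) / ((r + 1) / n ^ 2 * D / 2) := by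
    intro s
    have hlim : Tendsto (fun d => ∑ x ∈ s, (p x).toReal * tamePow d r (imbalance x.2))
        (𝓝[>] 0) (𝓝 (∑ x ∈ s, (p x).toReal * imbalance x.2 ^ r)) :=
      tendsto_finsetSum _ fun x _ => tendsto_tamePow.const_mul _
    refine le_of_tendsto hlim ?_
    filter_upwards [self_mem_nhdsWithin] with d hd
    refine le_trans ?_ (H.expect_tamePow_le hssc hW hδ hd hr1 hr2 hM hK hD hDδ ht hWr hA)
    refine Summable.sum_le_tsum s (fun x _ => mul_nonneg ENNReal.toReal_nonneg
      (tamePow_nonneg (one_le_imbalance _))) ?_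
    exact hasFiniteMean_of_bounded (C := 1 / d) fun x => by
      rw [abs_of_nonneg (tamePow_nonneg (one_le_imbalance _))]
      exact tamePow_le hd (one_le_imbalance _)
  have hnn : ∀ x : Z × (Fin n → ℕ), 0 ≤ (p x).toReal * imbalance x.2 ^ r := fun x =>
    mul_nonneg ENNReal.toReal_nonneg
      (Real.rpow_nonneg (zero_le_one.trans (one_le_imbalance _)) _)
  have hs : HasFiniteMean p (fun x => imbalance x.2 ^ r) := summable_of_sum_le hnn hfin
  exact ⟨hs, Summable.tsum_le_of_sum_le hs hfin⟩

/-- When a server idles, the total queue length is at most a multiple of the imbalance. -/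
theorem sum_le_imbalance [NeZero n] {q : Fin n → ℕ} {j : Fin n} (hj : q j = 0) :
    ((∑ l, q l : ℕ) : ℝ) ≤ n * imbalance q := by
  have hn : (0 : ℝ) < n := by exact_mod_cast NeZero.pos n
  have h := (abs_le.1 (abs_queueDev_le q j)).1
  rw [queueDev, hj, Nat.cast_zero, zero_sub, neg_le_neg_iff, div_le_iff₀ hn] at h
  push_cast
  linarith

/-- Truncation of `v` at level `K`: below it the small mean of the idle service is used, above it
only its boundedness. -/
theorem IsSteadyJSQ.abs_mul_idleService_le [NeZero n] (H : IsSteadyJSQ α stat lam μ M p)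
    {K r v : ℝ} (hK : 0 < K) (hr : 1 ≤ r) (x : Z × (Fin n → ℕ)) :
    |v * idleService μ x| ≤ K * idleService μ x + n * M * K ^ (1 - r) * |v| ^ r := by
  have h1 := idleService_nonneg H.mu_nonneg x
  have h2 := (idleService_le H.mu_nonneg x).trans (totalService_le H.mu_le x.1)
  have h3 := mul_le_mul_of_nonneg_right (le_add_rpow_mul (abs_nonneg v) hK hr) h1
  have h4 : 0 ≤ K ^ (1 - r) * |v| ^ r :=
    mul_nonneg (Real.rpow_nonneg hK.le _) (Real.rpow_nonneg (abs_nonneg _) _)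
  rw [abs_mul, abs_of_nonneg h1]
  nlinarith [mul_le_mul_of_nonneg_left h2 h4]

theorem IsSteadyJSQ.hasFiniteMean_idleService [NeZero n] (H : IsSteadyJSQ α stat lam μ M p) :
    HasFiniteMean p (idleService μ) :=
  hasFiniteMean_of_bounded (C := n * M) fun x => by
    rw [abs_of_nonneg (idleService_nonneg H.mu_nonneg x)]
    exact (idleService_le H.mu_nonneg x).trans (totalService_le H.mu_le x.1)

theorem IsSteadyJSQ.hasFiniteMean_hFun [NeZero n] (H : IsSteadyJSQ α stat lam μ M p) :
    HasFiniteMean stat (hFun lam μ) :=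
  hasFiniteMean_of_bounded (C := n * M + M) fun i => by
    have h1 := totalService_le H.mu_le i
    have h2 := totalService_nonneg H.mu_nonneg i
    have h3 := H.lam_nonneg i
    have h4 := H.lam_le i
    rw [abs_le, hFun]
    constructor <;> linarith

theorem IsSteadyJSQ.expect_idleService [NeZero n] (H : IsSteadyJSQ α stat lam μ M p) :
    expect p (idleService μ) = expect stat (hFun lam μ) := by
  have h1 := H.expect_netService_one
  have h2 := expect_sub (H.hasFiniteMean_fst H.hasFiniteMean_hFun) H.hasFiniteMean_idleService
  have h3 : (fun x : Z × (Fin n → ℕ) => hFun lam μ x.1 - idleService μ x) =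
      netService lam μ 1 := by
    funext x
    rw [hFun, netService]
    ring
  rw [h3, h1, H.expect_fst H.hasFiniteMean_hFun] at h2
  linarith

end Collapse

/-! ### The transform of the total queue length -/

section Transform

variable {Z : Type*} {n : ℕ} {α : Z → Z → ℝ} {stat : PMF Z} {lam : Z → ℝ}
  {μ : Z → Fin n → ℝ} {M : ℝ} {p : PMF (Z × (Fin n → ℕ))}

theorem IsSteadyJSQ.hasFiniteMean_totalService [NeZero n] (H : IsSteadyJSQ α stat lam μ M p) :
    HasFiniteMean stat (totalService μ) :=
  hasFiniteMean_of_bounded (C := n * M) fun i => by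
    rw [abs_of_nonneg (totalService_nonneg H.mu_nonneg i)]
    exact totalService_le H.mu_le i

theorem IsSteadyJSQ.abs_expect_pow_mul_netService_le [NeZero n]
    (H : IsSteadyJSQ α stat lam μ M p) {b : ℝ} (hb0 : 0 ≤ b) (hb1 : b ≤ 1) {V : Z → ℝ}
    (hV : HasFiniteMean stat V) :
    |expect p (fun x => b ^ (∑ j, x.2 j) * (V x.1 * netService lam μ b x))| ≤
      (n * M + M) * expect stat (fun i => |V i|) := by
  rw [← H.expect_fst hV.abs, ← expect_const_mul]
  refine abs_expect_le ((H.hasFiniteMean_fst hV.abs).const_mul _) fun x => ?_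
  rw [abs_mul, abs_mul]
  have h1 := abs_pow_le_one_of_le hb0 hb1 (∑ j, x.2 j)
  have h2 := H.abs_netService_le hb0 hb1 x
  calc _ ≤ 1 * (|V x.1| * (n * M + M)) :=
        mul_le_mul h1 (mul_le_mul_of_nonneg_left h2 (abs_nonneg _)) (by positivity) zero_le_one
    _ = _ := by ring

/-- Bernoulli's inequality bounds `1 - b ^ N` by `(1 - b) * N`. Idle service requires an empty
queue, and then the total length `N` is at most `n` times the imbalance, which is where state space
collapse enters. -/
theorem IsSteadyJSQ.expect_one_sub_pow_mul_idleService_le [NeZero n]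
    (H : IsSteadyJSQ α stat lam μ M p) {b K r C : ℝ} (hb0 : 0 ≤ b) (hb1 : b ≤ 1) (hK : 0 < K)
    (hr : 1 ≤ r) (hM : 0 ≤ M) (hy : HasFiniteMean p fun x => imbalance x.2 ^ r)
    (hC : expect p (fun x => imbalance x.2 ^ r) ≤ C) :
    |expect p (fun x => (1 - b ^ (∑ j, x.2 j)) * idleService μ x)| ≤
      (1 - b) * n * (K * expect stat (hFun lam μ) + n * M * K ^ (1 - r) * C) := by
  have hn : (0 : ℝ) < n := by exact_mod_cast NeZero.pos n
  have hU := H.hasFiniteMean_idleService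
  have hub : HasFiniteMean p fun x => (1 - b) * n *
      (K * idleService μ x + n * M * K ^ (1 - r) * imbalance x.2 ^ r) :=
    ((hU.const_mul K).add (hy.const_mul _)).const_mul _
  refine (abs_expect_le hub fun x => ?_).trans ?_
  · have hb' : b ^ (∑ j, x.2 j) ≤ 1 := pow_le_one₀ hb0 hb1
    have hU0 := idleService_nonneg H.mu_nonneg x
    have hy1 := one_le_imbalance x.2
    rw [abs_of_nonneg (mul_nonneg (by linarith) hU0)]
    have h1 : (1 - b ^ (∑ j, x.2 j)) * idleService μ x ≤
        (1 - b) * n * |imbalance x.2 * idleService μ x| := by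
      rw [abs_of_nonneg (mul_nonneg (by linarith) hU0), ← mul_assoc]
      by_cases h : ∃ j, x.2 j = 0
      · obtain ⟨j, hj⟩ := h
        refine mul_le_mul_of_nonneg_right ?_ hU0
        have h2 := one_add_mul_le_pow (a := b - 1) (by linarith) (∑ l, x.2 l)
        rw [show 1 + (b - 1) = b by ring] at h2
        have h3 := mul_le_mul_of_nonneg_left (sum_le_imbalance hj)
          (by linarith : 0 ≤ 1 - b)
        linarith
      · have : idleService μ x = 0 := Finset.sum_eq_zero fun j _ => if_neg fun hj => h ⟨j, hj⟩
        simp [this]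
    refine h1.trans (mul_le_mul_of_nonneg_left ?_ (mul_nonneg (by linarith) hn.le))
    have h2 := H.abs_mul_idleService_le (v := imbalance x.2) hK hr x
    rwa [abs_of_nonneg (by linarith : 0 ≤ imbalance x.2)] at h2
  · rw [expect_const_mul, expect_add (hU.const_mul K) (hy.const_mul _), expect_const_mul,
      expect_const_mul, H.expect_idleService]
    have h1 : 0 ≤ n * M * K ^ (1 - r) :=
      mul_nonneg (by positivity) (Real.rpow_nonneg hK.le _)
    refine mul_le_mul_of_nonneg_left ?_ (mul_nonneg (by linarith) hn.le)
    linarith [mul_le_mul_of_nonneg_left hC h1]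

/-- The transform of the total queue length, up to explicit error terms. -/
theorem IsSteadyJSQ.abs_transform_sub_le [NeZero n] (H : IsSteadyJSQ α stat lam μ M p)
    {b K r A C : ℝ} (hb0 : 1 / 2 ≤ b) (hb1 : b < 1) (hK : 0 < K) (hr : 1 ≤ r) (hM : 0 ≤ M)
    {V Vk Vl : Z → ℝ} (hV : IsPoissonSolution α stat (hFun lam μ) V)
    (hVr : HasFiniteMean stat fun i => |V i| ^ r) (hVA : expect stat (fun i => |V i| ^ r) ≤ A)
    (hVA' : expect stat (fun i => |V i|) ≤ A)
    (hVk : IsPoissonSolution α stat (kFun lam μ V) Vk) (hVk1 : HasFiniteMean stat Vk)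
    (hVkA : expect stat (fun i => |Vk i|) ≤ A)
    (hVl : IsPoissonSolution α stat (totalService μ) Vl) (hVl1 : HasFiniteMean stat Vl)
    (hVlA : expect stat (fun i => |Vl i|) ≤ A)
    (hy : HasFiniteMean p fun x => imbalance x.2 ^ r)
    (hC : expect p (fun x => imbalance x.2 ^ r) ≤ C) :
    |expect p (fun x => b ^ (∑ j, x.2 j)) * (b * expect stat (hFun lam μ) +
        (1 - b) * (expect stat (kFun lam μ V) + expect stat (totalService μ))) -
      expect stat (hFun lam μ)| ≤
      (1 - b) * ((1 - b) * (5 * ((n * M + M) * A)) + (n + 1) *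
        (K * expect stat (hFun lam μ) + n * M * K ^ (1 - r) * (A + C))) := by
  have hn : (0 : ℝ) < n := by exact_mod_cast NeZero.pos n
  have hb00 : 0 < b := by linarith
  have hV1 : HasFiniteMean stat V := hVr.of_rpow hr
  have hbd : ∀ x : Z × (Fin n → ℕ), |b ^ (∑ j, x.2 j)| ≤ 1 :=
    fun x => abs_pow_le_one_of_le hb00.le hb1.le _
  have hψ : HasFiniteMean p fun x : Z × (Fin n → ℕ) => b ^ (∑ j, x.2 j) :=
    hasFiniteMean_of_bounded hbd
  have mf : ∀ {f : Z × (Fin n → ℕ) → ℝ}, HasFiniteMean p f →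
      HasFiniteMean p fun x => b ^ (∑ j, x.2 j) * f x := fun hf => hf.bounded_mul hbd
  have hU := H.hasFiniteMean_idleService
  have mh := mf (H.hasFiniteMean_fst H.hasFiniteMean_hFun)
  have mμ := mf (H.hasFiniteMean_fst H.hasFiniteMean_totalService)
  have mk := mf (H.hasFiniteMean_fst hVk.1)
  have hlamV : HasFiniteMean stat fun i => lam i * V i :=
    HasFiniteMean.bounded_mul (C := M)
      (fun i => by rw [abs_of_nonneg (H.lam_nonneg i)]; exact H.lam_le i) hV1
  have mlV := mf (H.hasFiniteMean_fst hlamV)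
  have hVU : HasFiniteMean p fun x => V x.1 * idleService μ x := by
    simp only [mul_comm (V _)]
    exact HasFiniteMean.bounded_mul (C := n * M) (fun x => by
      rw [abs_of_nonneg (idleService_nonneg H.mu_nonneg x)]
      exact (idleService_le H.mu_nonneg x).trans (totalService_le H.mu_le x.1))
      (H.hasFiniteMean_fst hV1)
  have mVU := mf hVU
  have mU' : HasFiniteMean p fun x => (1 - b ^ (∑ j, x.2 j)) * idleService μ x := by
    simpa only [sub_mul, one_mul] using hU.sub (mf hU)
  -- the four identities
  have e1 : b * expect p (fun x => b ^ (∑ j, x.2 j) * hFun lam μ x.1) +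
      (1 - b) * expect p (fun x => b ^ (∑ j, x.2 j) * totalService μ x.1) -
      (expect p (idleService μ) -
        expect p (fun x => (1 - b ^ (∑ j, x.2 j)) * idleService μ x)) = 0 := by
    rw [← expect_const_mul, ← expect_const_mul, ← expect_add (mh.const_mul _) (mμ.const_mul _),
      ← expect_sub hU mU', ← expect_sub ((mh.const_mul _).add (mμ.const_mul _)) (hU.sub mU'),
      ← H.expect_pow_mul_netService hb00 hb1]
    congr 1
    funext x
    rw [netService, hFun]
    ring
  have e2 := H.expect_pow_mul hb00 hb1.le hV hV1
  -- Here `netService` equals `h + (1 - b) * lam - idleService`. The correction from the Poisson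
  -- equation of `h` thus reproduces `k = h * V`, to which the averaging identity applies a second
  -- time.
  have e2' : expect p (fun x => b ^ (∑ j, x.2 j) * (V x.1 * netService lam μ b x)) =
      expect p (fun x => b ^ (∑ j, x.2 j) * kFun lam μ V x.1) +
      (1 - b) * expect p (fun x => b ^ (∑ j, x.2 j) * (lam x.1 * V x.1)) -
      expect p (fun x => b ^ (∑ j, x.2 j) * (V x.1 * idleService μ x)) := by
    rw [← expect_const_mul, ← expect_add mk (mlV.const_mul _),
      ← expect_sub (mk.add (mlV.const_mul _)) mVU]
    congr 1
    funext x
    rw [netService, kFun]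
    ring
  have e3 := H.expect_pow_mul hb00 hb1.le hVk hVk1
  have e4 := H.expect_pow_mul hb00 hb1.le hVl hVl1
  -- bounds on the remainders
  have r1 := H.expect_one_sub_pow_mul_idleService_le hb00.le hb1.le hK hr hM hy hC
  have hB : 0 ≤ n * M + M := by positivity
  have r3 := (H.abs_expect_pow_mul_netService_le hb00.le hb1.le hVk1).trans
    (mul_le_mul_of_nonneg_left hVkA hB)
  have r6 := (H.abs_expect_pow_mul_netService_le hb00.le hb1.le hVl1).trans
    (mul_le_mul_of_nonneg_left hVlA hB)
  have r4 : |expect p (fun x => b ^ (∑ j, x.2 j) * (lam x.1 * V x.1))| ≤ (n * M + M) * A := by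
    refine le_trans (abs_expect_le ((H.hasFiniteMean_fst hV1.abs).const_mul M) fun x => ?_) ?_
    · rw [abs_mul, abs_mul, abs_of_nonneg (H.lam_nonneg _)]
      calc _ ≤ 1 * (M * |V x.1|) :=
            mul_le_mul (hbd x) (mul_le_mul_of_nonneg_right (H.lam_le _) (abs_nonneg _))
              (mul_nonneg (H.lam_nonneg _) (abs_nonneg _)) zero_le_one
        _ = _ := one_mul _
    · rw [expect_const_mul, H.expect_fst hV1.abs]
      have h1 : 0 ≤ expect stat fun i => |V i| := expect_nonneg fun i => abs_nonneg _
      have h2 : M * expect stat (fun i => |V i|) ≤ (n * M + M) * expect stat (fun i => |V i|) :=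
        mul_le_mul_of_nonneg_right (by nlinarith) h1
      exact h2.trans (mul_le_mul_of_nonneg_left hVA' hB)
  have r5 : |expect p (fun x => b ^ (∑ j, x.2 j) * (V x.1 * idleService μ x))| ≤
      K * expect stat (hFun lam μ) + n * M * K ^ (1 - r) * A := by
    have mV := H.hasFiniteMean_fst hVr
    refine (abs_expect_le ((hU.const_mul K).add (mV.const_mul (n * M * K ^ (1 - r))))
      fun x => ?_).trans ?_
    · refine le_trans ?_ (H.abs_mul_idleService_le hK hr x)
      rw [abs_mul]
      exact mul_le_of_le_one_left (abs_nonneg _) (hbd x)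
    · rw [expect_add (hU.const_mul K) (mV.const_mul _), expect_const_mul, expect_const_mul,
        H.expect_idleService, H.expect_fst hVr]
      have h1 : 0 ≤ n * M * K ^ (1 - r) :=
        mul_nonneg (by positivity) (Real.rpow_nonneg hK.le _)
      linarith [mul_le_mul_of_nonneg_left hVA h1]
  have hA0 : 0 ≤ A := le_trans (expect_nonneg fun i => abs_nonneg _) hVA'
  have hC0 : 0 ≤ C := le_trans (expect_nonneg fun x =>
    Real.rpow_nonneg (zero_le_one.trans (one_le_imbalance _)) _) hC
  have hKK : 0 ≤ n * M * K ^ (1 - r) := mul_nonneg (by positivity) (Real.rpow_nonneg hK.le _)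
  have he0 : 0 ≤ expect stat (hFun lam μ) := by
    rw [← H.expect_idleService]
    exact expect_nonneg fun x => idleService_nonneg H.mu_nonneg x
  rw [H.expect_idleService] at e1
  generalize expect p (fun x => b ^ (∑ j, x.2 j) * hFun lam μ x.1) = Eh at *
  generalize expect p (fun x => b ^ (∑ j, x.2 j) * totalService μ x.1) = Eμ at *
  generalize expect p (fun x => b ^ (∑ j, x.2 j) * kFun lam μ V x.1) = Ek at *
  generalize expect p (fun x => (1 - b ^ (∑ j, x.2 j)) * idleService μ x) = R1 at *
  generalize expect p (fun x => b ^ (∑ j, x.2 j) * (V x.1 * netService lam μ b x)) = R2 at *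
  generalize expect p (fun x => b ^ (∑ j, x.2 j) * (Vk x.1 * netService lam μ b x)) = R3 at *
  generalize expect p (fun x => b ^ (∑ j, x.2 j) * (lam x.1 * V x.1)) = R4 at *
  generalize expect p (fun x => b ^ (∑ j, x.2 j) * (V x.1 * idleService μ x)) = R5 at *
  generalize expect p (fun x => b ^ (∑ j, x.2 j) * (Vl x.1 * netService lam μ b x)) = R6 at *
  generalize expect p (fun x => b ^ (∑ j, x.2 j)) = ψ at *
  generalize expect stat (hFun lam μ) = e at *
  generalize expect stat (kFun lam μ V) = k at *
  generalize expect stat (totalService μ) = m at *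
  set τ := b⁻¹ - 1 with hτ
  have hbτ : b * τ = 1 - b := by rw [hτ, mul_sub, mul_inv_cancel₀ hb00.ne', mul_one]
  have hτ0 : 0 ≤ τ := by
    have := (one_lt_inv₀ hb00).2 hb1
    linarith
  have hτ2 : τ ≤ 2 * (1 - b) := by nlinarith
  have hx : 0 < 1 - b := by linarith
  have key : ψ * (b * e + (1 - b) * (k + m)) - e =
      (1 - b) * (R5 - (1 - b) * R4 - τ * (R3 + R6)) - R1 := by
    have : b * Eh = b * (e * ψ) + (1 - b) * R2 := by rw [e2, mul_add, ← mul_assoc b τ, hbτ]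
    rw [this, e2', e3, e4] at e1
    linarith
  rw [key]
  -- The factor `5` counts one `R4` and, because `τ ≤ 2 * (1 - b)`, twice each of `R3` and `R6`.
  have t1 : |R5 - (1 - b) * R4 - τ * (R3 + R6)| ≤
      (K * e + n * M * K ^ (1 - r) * A) + (1 - b) * (5 * ((n * M + M) * A)) := by
    have hBA : 0 ≤ (n * M + M) * A := mul_nonneg hB hA0
    have s1 : |(1 - b) * R4| ≤ (1 - b) * ((n * M + M) * A) := by
      rw [abs_mul, abs_of_pos hx]; exact mul_le_mul_of_nonneg_left r4 hx.le
    have s2 : |τ * (R3 + R6)| ≤ 2 * (1 - b) * (2 * ((n * M + M) * A)) := by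
      rw [abs_mul, abs_of_nonneg hτ0]
      exact mul_le_mul hτ2 ((abs_add_le _ _).trans (by linarith)) (abs_nonneg _) (by linarith)
    have := abs_sub (R5 - (1 - b) * R4) (τ * (R3 + R6))
    have := abs_sub R5 ((1 - b) * R4)
    linarith
  have t2 := abs_sub ((1 - b) * (R5 - (1 - b) * R4 - τ * (R3 + R6))) R1
  rw [abs_mul, abs_of_pos hx] at t2
  have t3 := mul_le_mul_of_nonneg_left t1 hx.le
  have t4 : 0 ≤ (1 - b) * (n * M * K ^ (1 - r) * C) := by positivity
  have t5 : 0 ≤ (1 - b) * (n * (n * M * K ^ (1 - r) * A)) := by positivity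
  refine t2.trans ((add_le_add t3 r1).trans ?_)
  linarith

end Transform

/-! ### Solutions to the Poisson equation -/

section Poisson

variable {Z : Type*} {α : Z → Z → ℝ} {stat : PMF Z} {f g V W : Z → ℝ}

theorem isPoissonSolution_iff (hα : IsRateMatrix α) : IsPoissonSolution α stat f V ↔
    HasFiniteMean stat f ∧ ∀ i, HasSum (fun i' => α i i' * V i') (expect stat f - f i) := by
  refine ⟨fun h => ⟨h.1, h.hasSum hα⟩, fun h => ⟨h.1, fun i => ?_⟩⟩
  have h1 : HasSum (fun i' : {i' // i' ≠ i} => α i i' * V i')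
      (exitRate α i * V i + expect stat f - f i) :=
    (hasSum_ne_iff (f := fun i' => α i i' * V i')).2
      ((h.2 i).of_eq (fun _ => rfl) (by rw [hα.diag]; ring))
  refine ⟨h1.summable, ?_⟩
  rw [h1.tsum_eq]
  ring

theorem IsPoissonSolution.add (hα : IsRateMatrix α) (h : IsPoissonSolution α stat f V)
    (h' : IsPoissonSolution α stat g W) :
    IsPoissonSolution α stat (fun i => f i + g i) fun i => V i + W i := by
  refine (isPoissonSolution_iff hα).2 ⟨h.1.add h'.1, fun i => ?_⟩
  refine ((h.hasSum hα i).add (h'.hasSum hα i)).of_eq (fun i' => by ring) ?_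
  rw [expect_add h.1 h'.1]
  ring

theorem IsPoissonSolution.const_mul (hα : IsRateMatrix α) (c : ℝ)
    (h : IsPoissonSolution α stat f V) :
    IsPoissonSolution α stat (fun i => c * f i) fun i => c * V i := by
  refine (isPoissonSolution_iff hα).2 ⟨h.1.const_mul c, fun i => ?_⟩
  refine ((h.hasSum hα i).mul_left c).of_eq (fun i' => by ring) ?_
  rw [expect_const_mul]
  ring

/-- Integrable solutions to the Poisson equation are unique up to an additive constant. -/
theorem IsPoissonSolution.sub_eq_expect (hα : IsRateMatrix α) (hb : HasBoundedRates α)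
    (hirr : IsIrreducibleChain α) (hs : IsStationaryDist α stat)
    (h : IsPoissonSolution α stat f V) (h' : IsPoissonSolution α stat f W)
    (hV : HasFiniteMean stat V) (hW : HasFiniteMean stat W) (i : Z) :
    V i - W i = expect stat V - expect stat W := by
  have hc := hs.harmonic_const hα hb hirr (hV.sub hW) (fun i =>
    ((h.hasSum hα i).sub (h'.hasSum hα i)).of_eq (fun i' => by ring) (by ring))
  have h1 : (fun j => V j - W j) = fun _ => V i - W i := funext fun j => hc j i
  rw [← expect_sub hV hW, h1, expect_const]

theorem HasFiniteMean.rpow_add {X : Type*} {p : PMF X} {f g : X → ℝ} {r : ℝ} (hr : 0 ≤ r)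
    (hf : HasFiniteMean p fun x => |f x| ^ r) (hg : HasFiniteMean p fun x => |g x| ^ r) :
    HasFiniteMean p fun x => |f x + g x| ^ r := by
  refine ((hf.add hg).const_mul (2 ^ r)).of_le fun x => ?_
  have h0 := Real.rpow_nonneg (abs_nonneg (f x)) r
  have h1 := Real.rpow_nonneg (abs_nonneg (g x)) r
  have h2 : (0 : ℝ) ≤ 2 ^ r := by positivity
  rw [abs_of_nonneg (Real.rpow_nonneg (abs_nonneg _) r)]
  rcases le_total |f x| |g x| with h | h
  · calc |f x + g x| ^ r ≤ (2 * |g x|) ^ r :=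
          Real.rpow_le_rpow (abs_nonneg _) ((abs_add_le _ _).trans (by linarith)) hr
      _ = 2 ^ r * |g x| ^ r := Real.mul_rpow (by norm_num) (abs_nonneg _)
      _ ≤ _ := mul_le_mul_of_nonneg_left (by linarith) h2
  · calc |f x + g x| ^ r ≤ (2 * |f x|) ^ r :=
          Real.rpow_le_rpow (abs_nonneg _) ((abs_add_le _ _).trans (by linarith)) hr
      _ = 2 ^ r * |f x| ^ r := Real.mul_rpow (by norm_num) (abs_nonneg _)
      _ ≤ _ := mul_le_mul_of_nonneg_left (by linarith) h2

theorem HasFiniteMean.rpow_const_mul {X : Type*} {p : PMF X} {f : X → ℝ} {r : ℝ} (c : ℝ)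
    (hf : HasFiniteMean p fun x => |f x| ^ r) : HasFiniteMean p fun x => |c * f x| ^ r := by
  simp only [abs_mul, Real.mul_rpow (abs_nonneg _) (abs_nonneg _)]
  exact hf.const_mul _

theorem HasFiniteMean.rpow_of_le {X : Type*} {p : PMF X} {f g : X → ℝ} {r : ℝ} (hr : 0 ≤ r)
    (hg : HasFiniteMean p fun x => |g x| ^ r) (h : ∀ x, |f x| ≤ g x) :
    HasFiniteMean p fun x => |f x| ^ r :=
  hg.of_le fun x => by
    rw [abs_of_nonneg (Real.rpow_nonneg (abs_nonneg _) r)]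
    exact Real.rpow_le_rpow (abs_nonneg _) ((h x).trans (le_abs_self _)) hr

theorem expect_rpow_le {X : Type*} {p : PMF X} {f g : X → ℝ} {r : ℝ} (hr : 0 ≤ r)
    (hg : HasFiniteMean p fun x => |g x| ^ r) (h : ∀ x, |f x| ≤ g x) :
    expect p (fun x => |f x| ^ r) ≤ expect p fun x => |g x| ^ r :=
  expect_mono (hg.rpow_of_le hr h) hg fun x =>
    Real.rpow_le_rpow (abs_nonneg _) ((h x).trans (le_abs_self _)) hr

theorem HasFiniteMean.rpow_of_rpow_le {X : Type*} {p : PMF X} {f : X → ℝ} {r r' : ℝ}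
    (hr : 0 ≤ r) (hrr : r ≤ r') (hf : HasFiniteMean p fun x => |f x| ^ r') :
    HasFiniteMean p fun x => |f x| ^ r :=
  ((hasFiniteMean_const 1).add hf).of_le fun x => by
    rw [abs_of_nonneg (Real.rpow_nonneg (abs_nonneg _) r)]
    have h0 := Real.rpow_nonneg (abs_nonneg (f x)) r'
    rcases le_total |f x| 1 with h | h
    · linarith [Real.rpow_le_one (abs_nonneg (f x)) h hr]
    · linarith [Real.rpow_le_rpow_of_exponent_le h hrr]

end Poisson

/-! ### Families with affine arrival rates -/

section Family

variable {Z : Type*} {n : ℕ} {α : Z → Z → ℝ} {stat : PMF Z} {μ : Z → Fin n → ℝ}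

theorem hFun_affine {lam : ℝ → Z → ℝ} {ε₀ : ℝ}
    (hlamaff : ∃ a b : Z → ℝ, ∀ ε ∈ Ioo 0 ε₀, ∀ i, lam ε i = a i + ε * b i)
    {e e₁ e₂ : ℝ} (he : e ∈ Ioo 0 ε₀) (he₁ : e₁ ∈ Ioo 0 ε₀) (he₂ : e₂ ∈ Ioo 0 ε₀)
    {t : ℝ} (ht : e = (1 - t) * e₁ + t * e₂) (i : Z) :
    hFun (lam e) μ i = (1 - t) * hFun (lam e₁) μ i + t * hFun (lam e₂) μ i := by
  obtain ⟨a, b, hab⟩ := hlamaff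
  simp only [hFun, hab e he, hab e₁ he₁, hab e₂ he₂]
  rw [ht]
  ring

/-- Since `h` is affine in the parameter, the same combination of two solutions solves the equation
at `e`. Uniqueness of integrable solutions leaves an additive constant, which is determined by the
means. -/
theorem poisson_hFun_interpolate (hα : IsRateMatrix α) (hb : HasBoundedRates α)
    (hirr : IsIrreducibleChain α) (hs : IsStationaryDist α stat) {lam : ℝ → Z → ℝ} {ε₀ : ℝ}
    (hlamaff : ∃ a b : Z → ℝ, ∀ ε ∈ Ioo 0 ε₀, ∀ i, lam ε i = a i + ε * b i) {Vh : ℝ → Z → ℝ}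
    (hVh : ∀ ε ∈ Ioo 0 ε₀, IsPoissonSolution α stat (hFun (lam ε) μ) (Vh ε))
    (hVh1 : ∀ ε ∈ Ioo 0 ε₀, HasFiniteMean stat (Vh ε))
    {e e₁ e₂ : ℝ} (he : e ∈ Ioo 0 ε₀) (he₁ : e₁ ∈ Ioo 0 ε₀) (he₂ : e₂ ∈ Ioo 0 ε₀)
    {t : ℝ} (ht : e = (1 - t) * e₁ + t * e₂) (i : Z) :
    Vh e i = (1 - t) * Vh e₁ i + t * Vh e₂ i + (expect stat (Vh e) -
      ((1 - t) * expect stat (Vh e₁) + t * expect stat (Vh e₂))) := by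
  have h2 := ((hVh e₁ he₁).const_mul hα (1 - t)).add hα ((hVh e₂ he₂).const_mul hα t)
  have h3 : (fun i => (1 - t) * hFun (lam e₁) μ i + t * hFun (lam e₂) μ i) = hFun (lam e) μ :=
    funext fun i => (hFun_affine hlamaff he he₁ he₂ ht i).symm
  rw [h3] at h2
  have m1 := (hVh1 e₁ he₁).const_mul (1 - t)
  have m2 := (hVh1 e₂ he₂).const_mul t
  have h4 := (hVh e he).sub_eq_expect hα hb hirr hs h2 (hVh1 e he) (m1.add m2) i
  rw [expect_add m1 m2, expect_const_mul, expect_const_mul] at h4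
  linarith

/-- Uniform control of the solutions to the Poisson equations along the family. -/
theorem exists_uniform_poisson (hα : IsRateMatrix α) (hb : HasBoundedRates α)
    (hirr : IsIrreducibleChain α) (hs : IsStationaryDist α stat) {lam : ℝ → Z → ℝ} {ε₀ : ℝ}
    (hε₀ : 0 < ε₀)
    (hlamaff : ∃ a b : Z → ℝ, ∀ ε ∈ Ioo 0 ε₀, ∀ i, lam ε i = a i + ε * b i) {m : ℝ}
    (hm : ∀ ε ∈ Ioo 0 ε₀, expect stat (hFun (lam ε) μ) = ε * m)
    {Vh Vk : ℝ → Z → ℝ} {r : ℝ} (hr : 1 ≤ r)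
    (hVh : ∀ ε ∈ Ioo 0 ε₀, IsPoissonSolution α stat (hFun (lam ε) μ) (Vh ε))
    (hVk : ∀ ε ∈ Ioo 0 ε₀, IsPoissonSolution α stat (kFun (lam ε) μ (Vh ε)) (Vk ε))
    (hVhr : ∀ ε ∈ Ioo 0 ε₀, HasFiniteMean stat fun i => |Vh ε i| ^ r)
    (hVk1 : ∀ ε ∈ Ioo 0 ε₀, HasFiniteMean stat (Vk ε))
    (hVh_norm : ∃ C, ∀ ε ∈ Ioo 0 ε₀, |expect stat (Vh ε)| ≤ C) :
    ∃ kstar A : ℝ, ∃ U : ℝ → Z → ℝ, ∀ ε ∈ Ioo 0 (ε₀ / 4),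
      expect stat (fun i => |Vh ε i| ^ r) ≤ A ∧ expect stat (fun i => |Vh ε i|) ≤ A ∧
      IsPoissonSolution α stat (kFun (lam ε) μ (Vh ε)) (U ε) ∧ HasFiniteMean stat (U ε) ∧
      expect stat (fun i => |U ε i|) ≤ A ∧
      expect stat (fun i => |Vh (ε₀ / 2) i - Vh ε i| ^ r) ≤ A ∧
      |expect stat (kFun (lam ε) μ (Vh ε)) - kstar| ≤ A * ε := by
  obtain ⟨C₀, hC₀⟩ := hVh_norm
  have hr0 : 0 ≤ r := by linarith
  have hVh1 : ∀ ε ∈ Ioo 0 ε₀, HasFiniteMean stat (Vh ε) := fun ε hε => (hVhr ε hε).of_rpow hr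
  set e₁ := ε₀ / 4 with he₁d
  have he₁ : e₁ ∈ Ioo 0 ε₀ := ⟨by positivity, by rw [he₁d]; linarith⟩
  have he₂ : ε₀ / 2 ∈ Ioo 0 ε₀ := ⟨by positivity, by linarith⟩
  have he₃ : 3 * ε₀ / 4 ∈ Ioo 0 ε₀ := ⟨by positivity, by linarith⟩
  have he₁0 : 0 < e₁ := he₁.1
  set h₁ := hFun (lam e₁) μ with hh₁
  set h₂ := hFun (lam (ε₀ / 2)) μ with hh₂
  set V₁ := Vh e₁ with hV₁
  set V₂ := Vh (ε₀ / 2) with hV₂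
  set c : ℝ → ℝ → ℝ := fun e t => expect stat (Vh e) -
    ((1 - t) * expect stat V₁ + t * expect stat V₂) with hc
  have hinterp : ∀ {e t : ℝ}, e ∈ Ioo 0 ε₀ → e = (1 - t) * e₁ + t * (ε₀ / 2) →
      (∀ i, hFun (lam e) μ i = (1 - t) * h₁ i + t * h₂ i) ∧
      ∀ i, Vh e i = (1 - t) * V₁ i + t * V₂ i + c e t := fun he ht =>
    ⟨hFun_affine hlamaff he he₁ he₂ ht,
      poisson_hFun_interpolate hα hb hirr hs hlamaff hVh hVh1 he he₁ he₂ ht⟩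
  -- the mixed term of `k`
  set c₃ := c (3 * ε₀ / 4) 2 with hc₃
  have h3 := hinterp (t := 2) he₃ (by rw [he₁d]; ring)
  -- Polarization: at the third point `3 * ε₀ / 4`, where `t = 2`, `k` equals `h₁ V₁ + 4 h₂ V₂ - 2
  -- (h₁ V₂ + h₂ V₁) + c₃ h`. Solving for the mixed term expresses it through functions whose
  -- Poisson equations have given solutions.
  set Um : Z → ℝ := fun i => (1 / 2) * (Vk e₁ i + (4 * Vk (ε₀ / 2) i +
    (c₃ * Vh (3 * ε₀ / 4) i + (-1) * Vk (3 * ε₀ / 4) i))) with hUm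
  have hUm1 : HasFiniteMean stat Um :=
    ((hVk1 _ he₁).add (((hVk1 _ he₂).const_mul 4).add (((hVh1 _ he₃).const_mul c₃).add
      ((hVk1 _ he₃).const_mul (-1))))).const_mul _
  have hUmP : IsPoissonSolution α stat (fun i => h₁ i * V₂ i + h₂ i * V₁ i) Um := by
    have h := ((hVk _ he₁).add hα (((hVk _ he₂).const_mul hα 4).add hα
      (((hVh _ he₃).const_mul hα c₃).add hα ((hVk _ he₃).const_mul hα (-1))))).const_mul hα (1 / 2)
    have e : (fun i => (1 / 2) * (kFun (lam e₁) μ (Vh e₁) i +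
        (4 * kFun (lam (ε₀ / 2)) μ (Vh (ε₀ / 2)) i + (c₃ * hFun (lam (3 * ε₀ / 4)) μ i +
          (-1) * kFun (lam (3 * ε₀ / 4)) μ (Vh (3 * ε₀ / 4)) i)))) =
        fun i => h₁ i * V₂ i + h₂ i * V₁ i := by
      funext i
      change (1 / 2) * (h₁ i * V₁ i + (4 * (h₂ i * V₂ i) +
        (c₃ * hFun (lam (3 * ε₀ / 4)) μ i +
          (-1) * (hFun (lam (3 * ε₀ / 4)) μ i * Vh (3 * ε₀ / 4) i)))) = _
      rw [h3.1, h3.2, ← hc₃]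
      ring
    rwa [e] at h
  -- interpolation for small `ε`
  have hsmall : ∀ {ε : ℝ}, ε ∈ Ioo 0 e₁ → ε ∈ Ioo 0 ε₀ := fun h => ⟨h.1, h.2.trans he₁.2⟩
  have hi : ∀ {ε : ℝ}, ε ∈ Ioo 0 e₁ → _ := fun {ε} h =>
    hinterp (t := ε / e₁ - 1) (hsmall h) (by
      rw [show ε₀ / 2 = 2 * e₁ by rw [he₁d]; ring]; field_simp; ring)
  set B : ℝ := C₀ + (2 * |expect stat V₁| + |expect stat V₂|) with hB
  have hz : ∀ {ε : ℝ}, ε ∈ Ioo 0 e₁ → 0 < ε / e₁ ∧ ε / e₁ < 1 := fun h =>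
    ⟨div_pos h.1 he₁0, (div_lt_one he₁0).2 h.2⟩
  have ht1 : ∀ {ε : ℝ}, ε ∈ Ioo 0 e₁ → |ε / e₁ - 1| ≤ 1 := fun h => by
    rw [abs_le]; constructor <;> linarith [hz h]
  have ht2 : ∀ {ε : ℝ}, ε ∈ Ioo 0 e₁ → |1 - (ε / e₁ - 1)| ≤ 2 := fun h => by
    rw [abs_le]; constructor <;> linarith [hz h]
  have hcB : ∀ {ε : ℝ}, ε ∈ Ioo 0 e₁ → |c ε (ε / e₁ - 1)| ≤ B := by
    intro ε h
    have a1 := abs_sub (expect stat (Vh ε)) ((1 - (ε / e₁ - 1)) * expect stat V₁ +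
      (ε / e₁ - 1) * expect stat V₂)
    have a2 := abs_add_le ((1 - (ε / e₁ - 1)) * expect stat V₁) ((ε / e₁ - 1) * expect stat V₂)
    rw [abs_mul, abs_mul] at a2
    have a3 := mul_le_mul_of_nonneg_right (ht1 h) (abs_nonneg (expect stat V₂))
    have a4 := mul_le_mul_of_nonneg_right (ht2 h) (abs_nonneg (expect stat V₁))
    have a5 := hC₀ ε (hsmall h)
    simp only [hc, hB]
    linarith
  have hB0 : 0 ≤ B := (abs_nonneg _).trans (hcB (ε := e₁ / 2) ⟨by positivity, by linarith⟩)
  -- A majorant independent of `ε`: the coefficients satisfy `|1 - t| ≤ 2` and `|t| ≤ 1`. The second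
  -- `|V₂ i|` makes it dominate `V₂ - Vh ε` too.
  set w : Z → ℝ := fun i => 2 * |V₁ i| + (2 * |V₂ i| + B) with hw
  have hwr : HasFiniteMean stat fun i => |w i| ^ r :=
    HasFiniteMean.rpow_add hr0
      (HasFiniteMean.rpow_const_mul 2 (by simpa only [abs_abs] using hVhr e₁ he₁))
      (HasFiniteMean.rpow_add hr0
        (HasFiniteMean.rpow_const_mul 2 (by simpa only [abs_abs] using hVhr _ he₂))
        (hasFiniteMean_const (|B| ^ r)))
  have hw1 : HasFiniteMean stat w := hwr.of_rpow hr
  have hVw : ∀ {ε : ℝ}, ε ∈ Ioo 0 e₁ → ∀ i, |Vh ε i| + |V₂ i| ≤ w i := by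
    intro ε h i
    rw [(hi h).2 i]
    have a1 := abs_add_le ((1 - (ε / e₁ - 1)) * V₁ i + (ε / e₁ - 1) * V₂ i) (c ε (ε / e₁ - 1))
    have a2 := abs_add_le ((1 - (ε / e₁ - 1)) * V₁ i) ((ε / e₁ - 1) * V₂ i)
    rw [abs_mul, abs_mul] at a2
    have a3 := mul_le_mul_of_nonneg_right (ht1 h) (abs_nonneg (V₂ i))
    have a4 := mul_le_mul_of_nonneg_right (ht2 h) (abs_nonneg (V₁ i))
    have a5 := hcB h
    simp only [hw]
    linarith
  have hVw' : ∀ {ε : ℝ}, ε ∈ Ioo 0 e₁ → ∀ i, |Vh ε i| ≤ w i := fun h i => by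
    linarith [hVw h i, abs_nonneg (V₂ i)]
  have hWw : ∀ {ε : ℝ}, ε ∈ Ioo 0 e₁ → ∀ i, |V₂ i - Vh ε i| ≤ w i := fun {ε} h i => by
    linarith [hVw h i, abs_sub (V₂ i) (Vh ε i)]
  -- The given `Vk ε` come without a bound uniform in `ε`, if only because of their free constants.
  -- `U ε` is another solution of the same equation, assembled from finitely many fixed functions
  -- and `Vh ε`, all under control.
  set U : ℝ → Z → ℝ := fun ε i => (1 - (ε / e₁ - 1)) ^ 2 * Vk e₁ i +
    ((1 - (ε / e₁ - 1)) * (ε / e₁ - 1) * Um i + ((ε / e₁ - 1) ^ 2 * Vk (ε₀ / 2) i +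
      c ε (ε / e₁ - 1) * Vh ε i)) with hU
  set v : Z → ℝ := fun i => 4 * |Vk e₁ i| + (2 * |Um i| + (|Vk (ε₀ / 2) i| + B * w i)) with hv
  have hv1 : HasFiniteMean stat v :=
    ((hVk1 _ he₁).abs.const_mul 4).add ((hUm1.abs.const_mul 2).add
      ((hVk1 _ he₂).abs.add (hw1.const_mul B)))
  have hUv : ∀ {ε : ℝ}, ε ∈ Ioo 0 e₁ → ∀ i, |U ε i| ≤ v i := by
    intro ε h i
    have b1 := ht1 h
    have b2 := ht2 h
    have b3 := hcB h
    have b4 := hVw' h i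
    simp only [hU, hv]
    generalize ε / e₁ - 1 = t at *
    refine (abs_add_le _ _).trans (add_le_add ?_ ((abs_add_le _ _).trans (add_le_add ?_
      ((abs_add_le _ _).trans (add_le_add ?_ ?_)))))
    · rw [abs_mul, abs_pow]
      exact mul_le_mul_of_nonneg_right (by nlinarith [abs_nonneg (1 - t)]) (abs_nonneg _)
    · rw [abs_mul, abs_mul]
      exact mul_le_mul_of_nonneg_right (by nlinarith [abs_nonneg (1 - t), abs_nonneg t])
        (abs_nonneg _)
    · rw [abs_mul, abs_pow]
      exact mul_le_of_le_one_left (abs_nonneg _) (pow_le_one₀ (abs_nonneg _) b1)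
    · rw [abs_mul]
      exact mul_le_mul b3 b4 (abs_nonneg _) hB0
  set K₁ := expect stat (kFun (lam e₁) μ V₁) with hK₁
  set Km := expect stat (fun i => h₁ i * V₂ i + h₂ i * V₁ i) with hKm
  set K₂ := expect stat (kFun (lam (ε₀ / 2)) μ V₂) with hK₂
  have hk : ∀ {ε : ℝ}, ε ∈ Ioo 0 e₁ → kFun (lam ε) μ (Vh ε) = fun i =>
      (1 - (ε / e₁ - 1)) ^ 2 * kFun (lam e₁) μ V₁ i +
        ((1 - (ε / e₁ - 1)) * (ε / e₁ - 1) * (h₁ i * V₂ i + h₂ i * V₁ i) +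
          ((ε / e₁ - 1) ^ 2 * kFun (lam (ε₀ / 2)) μ V₂ i +
            c ε (ε / e₁ - 1) * hFun (lam ε) μ i)) := by
    intro ε h
    funext i
    change hFun (lam ε) μ i * Vh ε i = (1 - (ε / e₁ - 1)) ^ 2 * (h₁ i * V₁ i) +
        ((1 - (ε / e₁ - 1)) * (ε / e₁ - 1) * (h₁ i * V₂ i + h₂ i * V₁ i) +
          ((ε / e₁ - 1) ^ 2 * (h₂ i * V₂ i) + c ε (ε / e₁ - 1) * hFun (lam ε) μ i))
    rw [(hi h).1, (hi h).2]
    ring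
  set Q : ℝ := (4 * |K₁| + 3 * |Km| + 2 * |K₂|) / e₁ + B * |m| with hQ
  have hQ0 : 0 ≤ Q := by positivity
  set A₁ := expect stat (fun i => |w i| ^ r) with hA₁
  have hA₁0 : 0 ≤ A₁ := expect_nonneg fun i => Real.rpow_nonneg (abs_nonneg _) _
  have hA₂0 : 0 ≤ expect stat w := expect_nonneg fun i => by simp only [hw]; positivity
  have hA₃0 : 0 ≤ expect stat v := expect_nonneg fun i =>
    (abs_nonneg _).trans (hUv (ε := e₁ / 2) ⟨by positivity, by linarith⟩ i)
  -- At `ε = 0` one has `t = -1`, where `(1 - t) ^ 2`, `(1 - t) * t` and `t ^ 2` are `4`, `-2` and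
  -- `1`. The additive constant in `Vh ε` contributes itself times `ε * m`, which vanishes in the
  -- limit even if the constant does not converge.
  refine ⟨4 * K₁ - 2 * Km + K₂, A₁ + expect stat w + expect stat v + Q, U, fun ε h => ?_⟩
  refine ⟨?_, ?_, ?_, hv1.of_le (hUv h), ?_, ?_, ?_⟩
  · linarith [expect_rpow_le hr0 hwr (hVw' h)]
  · linarith [expect_mono (hVh1 _ (hsmall h)).abs hw1 (hVw' h)]
  · rw [hk h]
    exact ((hVk _ he₁).const_mul hα _).add hα ((hUmP.const_mul hα _).add hα
      (((hVk _ he₂).const_mul hα _).add hα ((hVh _ (hsmall h)).const_mul hα _)))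
  · linarith [expect_mono (hv1.of_le (hUv h)).abs hv1 (hUv h)]
  · linarith [expect_rpow_le hr0 hwr (hWw h)]
  · have m1 := (hVk _ he₁).1.const_mul ((1 - (ε / e₁ - 1)) ^ 2)
    have m2 := hUmP.1.const_mul ((1 - (ε / e₁ - 1)) * (ε / e₁ - 1))
    have m3 := (hVk _ he₂).1.const_mul ((ε / e₁ - 1) ^ 2)
    have m4 := (hVh _ (hsmall h)).1.const_mul (c ε (ε / e₁ - 1))
    rw [hk h, expect_add m1 (m2.add (m3.add m4)), expect_add m2 (m3.add m4), expect_add m3 m4,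
      expect_const_mul, expect_const_mul, expect_const_mul, expect_const_mul, hm ε (hsmall h),
      ← hK₁, ← hKm, ← hK₂]
    have b3 := hcB h
    obtain ⟨z0, z1⟩ := hz h
    generalize c ε (ε / e₁ - 1) = c' at *
    have hεz : ε = ε / e₁ * e₁ := by field_simp
    set z := ε / e₁ with hzd
    have e : (1 - (z - 1)) ^ 2 * K₁ + ((1 - (z - 1)) * (z - 1) * Km +
        ((z - 1) ^ 2 * K₂ + c' * (ε * m))) - (4 * K₁ - 2 * Km + K₂) =
        z * ((z - 4) * K₁ + ((3 - z) * Km + (z - 2) * K₂)) + ε * (c' * m) := by ring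
    have f1 : |(z - 4) * K₁ + ((3 - z) * Km + (z - 2) * K₂)| ≤
        4 * |K₁| + 3 * |Km| + 2 * |K₂| := by
      rw [add_assoc]
      refine (abs_add_le _ _).trans (add_le_add ?_ ((abs_add_le _ _).trans (add_le_add ?_ ?_)))
      all_goals
        rw [abs_mul]
        refine mul_le_mul_of_nonneg_right (abs_le.2 ⟨?_, ?_⟩) (abs_nonneg _) <;> linarith
    have f2 : |c' * m| ≤ B * |m| := by
      rw [abs_mul]; exact mul_le_mul_of_nonneg_right b3 (abs_nonneg _)
    rw [e]
    calc _ ≤ z * (4 * |K₁| + 3 * |Km| + 2 * |K₂|) + ε * (B * |m|) := by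
          refine (abs_add_le _ _).trans (add_le_add ?_ ?_)
          · rw [abs_mul, abs_of_pos z0]; exact mul_le_mul_of_nonneg_left f1 z0.le
          · rw [abs_mul, abs_of_pos h.1]; exact mul_le_mul_of_nonneg_left f2 h.1.le
      _ = Q * ε := by rw [hQ, hzd]; ring
      _ ≤ _ := mul_le_mul_of_nonneg_right (by linarith) h.1.le

end Family

/-- Replacing `1 - b` by `c * ε`, the factor `b` by `1` and `K` by `kstar` costs `O(ε ^ 2)`. After
division by `ε * m` this is `O(ε)`, which `ε ≤ g` absorbs into the rate `g`. -/
theorem abs_mul_sub_one_le_of_transform {ε b m K kstar ψ c g A E : ℝ} (hε : 0 < ε)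
    (hε1 : ε ≤ 1) (hεg : ε ≤ g) (hc : 0 < c) (hcε : c * ε ≤ 1 / 2)
    (hb : b = Real.exp (-(c * ε))) (hm : 0 < m) (hψ0 : 0 ≤ ψ) (hψ1 : ψ ≤ 1) (hA : 0 ≤ A)
    (hK : |K - kstar| ≤ A * ε)
    (h : |ψ * (b * (ε * m) + (1 - b) * (K + m)) - ε * m| ≤ ε * g * E) :
    |ψ * (1 + c * (1 + kstar / m)) - 1| ≤
      g * ((E + (c * m + c ^ 2 * (|kstar| + A + m) + c * A)) / m) := by
  have hθ0 : 0 < c * ε := mul_pos hc hε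
  have hb1 : 1 - b ≤ c * ε := by
    have := Real.add_one_le_exp (-(c * ε))
    rw [hb]; linarith
  have hb0 : 0 ≤ 1 - b := by
    rw [hb, sub_nonneg]; exact Real.exp_le_one_iff.2 (by linarith)
  have hb2 : |c * ε - (1 - b)| ≤ (c * ε) ^ 2 := by
    have := Real.abs_exp_sub_one_sub_id_le (x := -(c * ε)) (by
      rw [abs_neg, abs_of_pos hθ0]; linarith)
    rw [← hb, neg_sq] at this
    rwa [show c * ε - (1 - b) = b - 1 - -(c * ε) by ring]
  have hKb : |K| ≤ |kstar| + A := by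
    have h1 := abs_add_le (K - kstar) kstar
    rw [sub_add_cancel] at h1
    have h2 : A * ε ≤ A * 1 := mul_le_mul_of_nonneg_left hε1 hA
    linarith
  have e1 : ε * m * (ψ * (1 + c * (1 + kstar / m)) - 1) =
      (ψ * (b * (ε * m) + (1 - b) * (K + m)) - ε * m) +
        ψ * ((1 - b) * (ε * m) + ((c * ε - (1 - b)) * (K + m) + c * ε * (kstar - K))) := by
    field_simp
    ring
  have t1 : |(1 - b) * (ε * m)| ≤ ε * g * (c * m) := by
    rw [abs_of_nonneg (by positivity)]
    calc (1 - b) * (ε * m) ≤ c * ε * (g * m) := by gcongr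
      _ = _ := by ring
  have t2 : |(c * ε - (1 - b)) * (K + m)| ≤ ε * g * (c ^ 2 * (|kstar| + A + m)) := by
    rw [abs_mul]
    have : |K + m| ≤ |kstar| + A + m := by
      refine (abs_add_le _ _).trans ?_
      rw [abs_of_pos hm]; linarith
    calc _ ≤ (c * ε) ^ 2 * (|kstar| + A + m) := by gcongr
      _ = ε * ε * (c ^ 2 * (|kstar| + A + m)) := by ring
      _ ≤ _ := by gcongr
  have t3 : |c * ε * (kstar - K)| ≤ ε * g * (c * A) := by
    rw [abs_mul, abs_of_pos hθ0, abs_sub_comm]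
    calc _ ≤ c * ε * (A * g) := by
          gcongr; exact hK.trans (mul_le_mul_of_nonneg_left hεg hA)
      _ = _ := by ring
  have t4 : |ψ * ((1 - b) * (ε * m) + ((c * ε - (1 - b)) * (K + m) + c * ε * (kstar - K)))| ≤
      ε * g * (c * m + c ^ 2 * (|kstar| + A + m) + c * A) := by
    rw [abs_mul, abs_of_nonneg hψ0]
    refine (mul_le_of_le_one_left (abs_nonneg _) hψ1).trans ?_
    refine (abs_add_le _ _).trans ((add_le_add t1 ((abs_add_le _ _).trans
      (add_le_add t2 t3))).trans (le_of_eq (by ring)))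
  have t5 : ε * m * |ψ * (1 + c * (1 + kstar / m)) - 1| ≤
      ε * g * (E + (c * m + c ^ 2 * (|kstar| + A + m) + c * A)) := by
    have e2 := congrArg abs e1
    rw [abs_mul, abs_of_pos (mul_pos hε hm)] at e2
    rw [e2, mul_add (ε * g)]
    exact (abs_add_le _ _).trans (add_le_add h t4)
  rw [mul_div_assoc', le_div_iff₀ hm]
  have t6 : ε * (|ψ * (1 + c * (1 + kstar / m)) - 1| * m) ≤
      ε * (g * (E + (c * m + c ^ 2 * (|kstar| + A + m) + c * A))) := by linarith
  exact le_of_mul_le_mul_left t6 hε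

theorem theorem5 {Z : Type*} [Countable Z] {n : ℕ} [NeZero n]
    -- the modulating chain: ergodic, with bounded exit rates and stationary distribution `stat`
    (α : Z → Z → ℝ) (hα : IsRateMatrix α) (hαbdd : HasBoundedRates α)
    (hαirr : IsIrreducibleChain α)
    (stat : PMF Z) (hstat : IsStationaryDist α stat)
    -- the service rates, which do not depend on `ε`
    (μ : Z → Fin n → ℝ) (hμ : ∀ i j, 0 ≤ μ i j) (hμmax : ∃ M, ∀ i j, μ i j < M)
    -- the arrival rates of the system with parameter `ε = 1 - ρ`, which are affine in `ε`
    (ε₀ : ℝ) (hε₀ : 0 < ε₀) (hε₀' : ε₀ ≤ 1)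
    (lam : ℝ → Z → ℝ)
    (hlam : ∀ ε ∈ Ioo 0 ε₀, ∀ i, 0 ≤ lam ε i)
    (hlammax : ∃ M, ∀ ε ∈ Ioo 0 ε₀, ∀ i, lam ε i < M)
    (hlamaff : ∃ a b : Z → ℝ, ∀ ε ∈ Ioo 0 ε₀, ∀ i, lam ε i = a i + ε * b i)
    (hload : ∀ ε ∈ Ioo 0 ε₀, ε = 1 - meanLoad stat (lam ε) μ)
    (hssc : ∀ ε ∈ Ioo 0 ε₀, SSCLoadCondition (lam ε) μ)
    -- the law of the modulating state and the queue lengths in steady state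
    (p : ℝ → PMF (Z × (Fin n → ℕ)))
    (hp : ∀ ε ∈ Ioo 0 ε₀, IsStationaryDist (jsqRateMatrix α (lam ε) μ) (p ε))
    -- solutions to the Poisson equations of `h`, `k`, `ℓ`, and their moments
    (η ζ β : ℝ) (hη : 0 < η) (hζ : 0 < ζ) (hβ : 0 < β)
    (Vh Vk : ℝ → Z → ℝ) (Vl : Z → ℝ)
    (hVh : ∀ ε ∈ Ioo 0 ε₀, IsPoissonSolution α stat (hFun (lam ε) μ) (Vh ε))
    (hVk : ∀ ε ∈ Ioo 0 ε₀, IsPoissonSolution α stat (kFun (lam ε) μ (Vh ε)) (Vk ε))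
    (hVl : IsPoissonSolution α stat (totalService μ) Vl)
    (hVh_mom : ∀ ε ∈ Ioo 0 ε₀, HasFiniteMean stat fun i => |Vh ε i| ^ (1 + η))
    (hVk_mom : ∀ ε ∈ Ioo 0 ε₀, HasFiniteMean stat fun i => |Vk ε i| ^ (1 + ζ))
    (hVl_mom : HasFiniteMean stat fun i => |Vl i| ^ (1 + β))
    -- the free additive constant in `V_h` stays bounded as `ε` varies
    (hVh_norm : ∃ C, ∀ ε ∈ Ioo 0 ε₀, |expect stat (Vh ε)| ≤ C) :
    ∃ kstar : ℝ,
      Tendsto (fun ε => expect stat (kFun (lam ε) μ (Vh ε))) (𝓝[>] 0) (𝓝 kstar) ∧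
      ∀ s : ℝ, 0 < s →
        0 < 1 + s / n * (1 + kstar / meanTotalService stat μ) ∧
        (fun ε : ℝ =>
            expect (p ε) (fun x => Real.exp (-s * ε * ((∑ j, (x.2 j : ℝ)) / n))) -
              1 / (1 + s / n * (1 + kstar / meanTotalService stat μ)))
          =O[𝓝[>] 0] fun ε : ℝ => ε ^ (1 - 1 / (1 + min 1 η)) := by
  obtain ⟨M₁, hM₁⟩ := hμmax
  obtain ⟨M₂, hM₂⟩ := hlammax
  obtain ⟨M, hM0, hμM, hlamM⟩ : ∃ M : ℝ, 0 ≤ M ∧ (∀ i j, μ i j ≤ M) ∧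
      ∀ ε ∈ Ioo 0 ε₀, ∀ i, lam ε i ≤ M :=
    ⟨max (max M₁ M₂) 0, le_max_right _ _,
      fun i j => (hM₁ i j).le.trans ((le_max_left _ _).trans (le_max_left _ _)),
      fun ε hε i => (hM₂ ε hε i).le.trans ((le_max_right _ _).trans (le_max_left _ _))⟩
  have hn : (0 : ℝ) < n := by exact_mod_cast NeZero.pos n
  have H : ∀ ε ∈ Ioo 0 ε₀, IsSteadyJSQ α stat (lam ε) μ M (p ε) := fun ε hε =>
    ⟨hα, hαbdd, hαirr, hstat, hlam ε hε, hlamM ε hε, hμ, hμM, hp ε hε⟩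
  have hhalf : ε₀ / 2 ∈ Ioo 0 ε₀ := ⟨by positivity, by linarith⟩
  have hTm := (H _ hhalf).hasFiniteMean_totalService
  rw [meanTotalService_eq hμ hμM]
  set m := expect stat (totalService μ) with hmdef
  -- If `m = 0`, division by zero gives load `0`, so the parameter `ε₀ / 2` would equal `1`,
  -- contrary to `ε₀ ≤ 1`.
  have hm0 : 0 < m := by
    refine lt_of_le_of_ne (expect_nonneg fun i => totalService_nonneg hμ i) fun h => ?_
    have := hload _ hhalf
    rw [meanLoad, meanTotalService_eq hμ hμM, ← hmdef, ← h, div_zero] at this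
    linarith
  have hm : ∀ ε ∈ Ioo 0 ε₀, expect stat (hFun (lam ε) μ) = ε * m := by
    intro ε hε
    have hl : HasFiniteMean stat (lam ε) := hasFiniteMean_of_bounded (C := M) fun i => by
      rw [abs_of_nonneg (hlam ε hε i)]; exact hlamM ε hε i
    have h1 : expect stat (hFun (lam ε) μ) = m - expect stat (lam ε) := expect_sub hTm hl
    have h2 := hload ε hε
    rw [meanLoad, meanTotalService_eq hμ hμM, ← hmdef] at h2
    have h3 : expect stat (lam ε) / m * m = expect stat (lam ε) := div_mul_cancel₀ _ hm0.ne'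
    rw [h1, ← h3]
    linear_combination (-m) * h2
  obtain ⟨r, hrdef⟩ : ∃ r, r = 1 + min 1 η := ⟨_, rfl⟩
  have hr1 : 1 < r := by rw [hrdef]; linarith [lt_min one_pos hη]
  have hr2 : r ≤ 2 := by rw [hrdef]; linarith [min_le_left 1 η]
  have hrη : r ≤ 1 + η := by rw [hrdef]; linarith [min_le_right 1 η]
  rw [← hrdef]
  have hVhr : ∀ ε ∈ Ioo 0 ε₀, HasFiniteMean stat fun i => |Vh ε i| ^ r := fun ε hε =>
    (hVh_mom ε hε).rpow_of_rpow_le (by linarith) hrη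
  have hVk1 : ∀ ε ∈ Ioo 0 ε₀, HasFiniteMean stat (Vk ε) := fun ε hε =>
    (hVk_mom ε hε).of_rpow (by linarith)
  have hVl1 : HasFiniteMean stat Vl := hVl_mom.of_rpow (by linarith)
  obtain ⟨kstar, A, U, hU⟩ := exists_uniform_poisson hα hαbdd hαirr hstat hε₀ hlamaff hm hr1.le
    hVh hVk hVhr hVk1 hVh_norm
  have hA0 : 0 ≤ A := le_trans (expect_nonneg fun i => abs_nonneg _)
    (hU (ε₀ / 8) ⟨by positivity, by linarith⟩).2.1
  obtain ⟨C, hC⟩ := exists_imbalance_moment_bound α stat μ hM0 hr1.le hr2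
    (by positivity : 0 < ε₀ / 4 * m) A
  have hsmall : ∀ {ε}, ε ∈ Ioo 0 (ε₀ / 4) → ε ∈ Ioo 0 ε₀ := fun h =>
    ⟨h.1, by linarith [h.2]⟩
  have hcollapse : ∀ ε ∈ Ioo 0 (ε₀ / 4), HasFiniteMean (p ε) (fun x => imbalance x.2 ^ r) ∧
      expect (p ε) (fun x => imbalance x.2 ^ r) ≤ C := by
    intro ε h
    have hε := hsmall h
    have hWr : HasFiniteMean stat fun i => |Vh (ε₀ / 2) i + -1 * Vh ε i| ^ r :=
      HasFiniteMean.rpow_add (by linarith) (hVhr _ hhalf) ((hVhr _ hε).rpow_const_mul (-1))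
    -- The surplus at `ε` is the surplus at `ε₀ / 2`, which is positive, plus `lam ε - lam (ε₀ /
    -- 2)`. The latter serves as lower bound: its mean is `(ε₀ / 2 - ε) * m ≥ ε₀ / 4 * m`, and the
    -- difference of the two solutions `Vh` solves its Poisson equation.
    refine hC (lam ε) (p ε) (H ε hε) (hssc ε hε) _ _
      ((hVh _ hhalf).add hα ((hVh _ hε).const_mul hα (-1))) (fun i => ?_) ?_ hWr ?_
    · have := hssc _ hhalf i
      simp only [hFun]
      linarith
    · rw [expect_add (hVh _ hhalf).1 ((hVh _ hε).1.const_mul _), expect_const_mul, hm _ hhalf,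
        hm _ hε]
      nlinarith [h.2]
    · refine le_trans (le_of_eq ?_) (hU ε h).2.2.2.2.2.1
      simp only [neg_one_mul, ← sub_eq_add_neg]
  set Al := A + expect stat (fun i => |Vl i|) with hAl
  have hVl0 : 0 ≤ expect stat (fun i => |Vl i|) := expect_nonneg fun i => abs_nonneg _
  have hev : ∀ᶠ ε in 𝓝[>] (0 : ℝ), ε ∈ Ioo 0 (ε₀ / 4) := Ioo_mem_nhdsGT (by positivity)
  have hgpos : 0 < 1 - 1 / r := by
    rw [sub_pos, div_lt_one (by linarith)]; exact hr1
  refine ⟨kstar, ?_, fun s hs => ?_⟩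
  · rw [tendsto_iff_norm_sub_tendsto_zero]
    refine squeeze_zero' (Eventually.of_forall fun _ => norm_nonneg _) (g := fun ε => A * ε)
      (hev.mono fun ε h => (hU ε h).2.2.2.2.2.2) ?_
    have h1 : Tendsto (fun ε : ℝ => A * ε) (𝓝 0) (𝓝 (A * 0)) := by
      exact tendsto_id.const_mul A
    rw [mul_zero] at h1
    exact h1.mono_left nhdsWithin_le_nhds
  set c : ℝ := s / n with hc
  have hc0 : 0 < c := by positivity
  set X : ℝ := 1 + c * (1 + kstar / m) with hX
  set ψ : ℝ → ℝ := fun ε =>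
    expect (p ε) (fun x => Real.exp (-s * ε * ((∑ j, (x.2 j : ℝ)) / n))) with hψ
  have hψ' : ∀ ε, ψ ε = expect (p ε) fun x => Real.exp (-(c * ε)) ^ (∑ j, x.2 j) := by
    intro ε
    simp only [hψ]
    congr 1
    funext x
    rw [← Real.exp_nat_mul, hc]
    congr 1
    push_cast
    ring
  have hψ0 : ∀ ε, 0 ≤ ψ ε := fun ε => expect_nonneg fun x => (Real.exp_pos _).le
  have hψ1 : ∀ ε, 0 < ε → ψ ε ≤ 1 := fun ε hε => by
    rw [hψ']
    exact (le_abs_self _).trans (abs_expect_le_of_bounded fun x =>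
      abs_pow_le_one_of_le (Real.exp_pos _).le (Real.exp_le_one_iff.2 (by
        have := mul_pos hc0 hε; linarith)) _)
  obtain ⟨E, hE⟩ : ∃ E, E = c * (c * (5 * ((n * M + M) * Al)) +
      (n + 1) * (m + n * M * (Al + C))) := ⟨_, rfl⟩
  obtain ⟨B, hB⟩ : ∃ B, B = (E + (c * m + c ^ 2 * (|kstar| + A + m) + c * A)) / m := ⟨_, rfl⟩
  have hevc : ∀ᶠ ε in 𝓝[>] (0 : ℝ), ε ∈ Ioo 0 (1 / (2 * c)) := Ioo_mem_nhdsGT (by positivity)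
  have hmain : ∀ᶠ ε in 𝓝[>] (0 : ℝ), |ψ ε * X - 1| ≤ ε ^ (1 - 1 / r) * B := by
    filter_upwards [hev, hevc] with ε h hc2
    have hε := hsmall h
    have hε1 : ε ≤ 1 := hε.2.le.trans hε₀'
    obtain ⟨u1, u2, u3, u4, u5, -, u7⟩ := hU ε h
    obtain ⟨v1, v2⟩ := hcollapse ε h
    have hcε : c * ε ≤ 1 / 2 := by
      have := hc2.2.le
      rw [le_div_iff₀ (by positivity)] at this
      linarith
    have hθ0 : 0 < c * ε := mul_pos hc0 h.1
    have hb1 : 1 - Real.exp (-(c * ε)) ≤ c * ε := by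
      have := Real.add_one_le_exp (-(c * ε)); linarith
    have hb2 : Real.exp (-(c * ε)) < 1 := Real.exp_lt_one_iff.2 (by linarith)
    have hg0 : 0 ≤ ε ^ (1 - 1 / r) := Real.rpow_nonneg h.1.le _
    have hεg : ε ≤ ε ^ (1 - 1 / r) := by
      conv_lhs => rw [← Real.rpow_one ε]
      exact Real.rpow_le_rpow_of_exponent_ge h.1 hε1
        (by have : 0 ≤ 1 / r := by positivity
            linarith)
    -- This truncation level balances the two errors: both `K * ε` and `K ^ (1 - r)` equal `ε ^ (1 -
    -- 1 / r)`.
    have hT := (H ε hε).abs_transform_sub_le (b := Real.exp (-(c * ε))) (K := ε ^ (-(1 / r)))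
      (r := r) (A := Al) (C := C) (by linarith) hb2 (Real.rpow_pos_of_pos h.1 _) hr1.le hM0
      (hVh ε hε) (hVhr ε hε) (by linarith) (by linarith) u3 u4 (by linarith) hVl hVl1
      (by linarith) v1 v2
    rw [← hψ', hm ε hε, ← hmdef] at hT
    have k1 : ε ^ (-(1 / r)) * (ε * m) = ε ^ (1 - 1 / r) * m := by
      rw [← mul_assoc, ← Real.rpow_add_one h.1.ne', show -(1 / r) + 1 = 1 - 1 / r by ring]
    have k2 : (ε ^ (-(1 / r))) ^ (1 - r) = ε ^ (1 - 1 / r) := by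
      rw [← Real.rpow_mul h.1.le]
      congr 1
      field_simp
      ring
    rw [k1, k2] at hT
    rw [hB]
    refine abs_mul_sub_one_le_of_transform h.1 hε1 hεg hc0 hcε rfl hm0 (hψ0 ε)
      (hψ1 ε h.1) hA0 u7 (hT.trans ?_)
    generalize ε ^ (1 - 1 / r) = g at *
    have hC0 : 0 ≤ C := le_trans (expect_nonneg fun x =>
      Real.rpow_nonneg (zero_le_one.trans (one_le_imbalance _)) _) v2
    have hAl0 : 0 ≤ Al := by linarith
    calc _ ≤ c * ε * (c * g * (5 * ((n * M + M) * Al)) +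
          (n + 1) * (g * m + n * M * g * (Al + C))) := by
          have hcg : c * ε ≤ c * g := mul_le_mul_of_nonneg_left hεg hc0.le
          have := hb1.trans hcg
          gcongr
      _ = ε * g * E := by rw [hE]; ring
  have hg : Tendsto (fun ε : ℝ => ε ^ (1 - 1 / r)) (𝓝[>] 0) (𝓝 0) := by
    have h1 := (Real.continuousAt_rpow_const 0 (1 - 1 / r) (Or.inr hgpos.le)).tendsto
    rw [Real.zero_rpow hgpos.ne'] at h1
    exact h1.mono_left nhdsWithin_le_nhds
  -- Positivity of the denominator comes from the limit itself: `ψ ε * X → 1` with `0 ≤ ψ ε ≤ 1`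
  -- forces `max X 0 ≥ 1`. Then dividing by `X` does not increase the error.
  have hX1 : 1 ≤ X := by
    have h1 : Tendsto (fun ε : ℝ => 1 - ε ^ (1 - 1 / r) * B) (𝓝[>] 0) (𝓝 1) := by
      simpa using (hg.mul_const B).const_sub 1
    have h2 : 1 ≤ max X 0 := by
      refine le_of_tendsto h1 ?_
      filter_upwards [hmain, self_mem_nhdsWithin] with ε h hε
      have h3 := (abs_le.1 h).1
      have h4 : ψ ε * X ≤ ψ ε * max X 0 := mul_le_mul_of_nonneg_left (le_max_left _ _) (hψ0 ε)
      have h5 : ψ ε * max X 0 ≤ max X 0 :=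
        mul_le_of_le_one_left (le_max_right _ _) (hψ1 ε hε)
      linarith
    rcases le_max_iff.1 h2 with h | h
    · exact h
    · linarith
  refine ⟨by linarith, IsBigO.of_bound B ?_⟩
  filter_upwards [hmain, self_mem_nhdsWithin] with ε h hε
  have hX0 : 0 < X := by linarith
  rw [Real.norm_eq_abs, Real.norm_eq_abs, abs_of_nonneg (Real.rpow_nonneg (le_of_lt hε) _),
    mul_comm B]
  have e : ψ ε - 1 / X = (ψ ε * X - 1) / X := by field_simp
  change |ψ ε - 1 / X| ≤ _
  rw [e, abs_div, abs_of_pos hX0]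
  exact (div_le_self (abs_nonneg _) hX1).trans h
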